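/- Let $\ell>0$, $J=(0,\ell)$. Elements of $W^{1,2}(J)$ are identified with their continuous representatives, i.e. with the absolutely continuous $y:[0,\ell]\to\mathbb{C}$ with $y'\in L^2(J)$; $W^{1,2}_0(J)$ is the subspace of those with $y(0)=y(\ell)=0$, and $W^{-1,2}(J)$ is its dual. Let $q\in W^{-1,2}(J)$ be a complex distributional potential. A function $y\in W^{1,2}(J)$ solves $-y''+qy=\lambda y$ if $\int_0^\ell y'\phi'\,dx+(q\,|\,y\phi)=\lambda\int_0^\ell y\phi\,dx$ for all $\phi\in W^{1,2}_0(J)$. Assume that $f\in W^{1,2}(J)$ solves $-f''+qf=0$, that $f(x)\neq0$ for all $x\in[0,\ell]$, and that $f(0)=1$. Put $\mathbf{D}_fy=y'-\frac{f'}{f}y$ and $\mathbf{R}_fg(x)=f(x)\int_0^x\frac{1}{f^2(t)}\int_0^tf(s)g(s)\,ds\,dt$. The formal powers associated with $f$ are $$\varphi_f^{(0)}=f,\qquad \varphi_f^{(1)}(x)=f(x)\int_0^x\frac{dt}{f^2(t)},\qquad \varphi_f^{(k)}=k(k-1)\,\mathbf{R}_f\varphi_f^{(k-2)}\quad(k\ge2).$$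 For $\rho\in\mathbb{C}$ let $e_f(\rho,\cdot)$ be the solution of $-y''+qy=\rho^2y$ with $y(0)=1$ and $\mathbf{D}_fy(0)=i\rho$ (the latter for the continuous representative of $\mathbf{D}_fy$). Let $\mathcal{T}_\ell=\{(x,t): 0\le x\le\ell,\ |t|\le x\}$. Then there exists a kernel $K_f\in L^2(\mathcal{T}_\ell)$, with $K_f(x,\cdot)\in L^1(-x,x)$ for every $x\in(0,\ell)$, such that $$e_f(\rho,x)=e^{i\rho x}+\int_{-x}^{x}K_f(x,t)\,e^{i\rho t}\,dt\qquad\text{for all }0<x<\ell,\ \rho\in\mathbb{C},$$ and, for every such kernel, the operator $\mathbf{T}_fu(x)=u(x)+\int_{-x}^{x}K_f(x,t)u(t)\,dt$ satisfies $$\mathbf{T}_f[x^k]=\varphi_f^{(k)}(x)\qquad\text{for all }k\in\mathbb{N}_0,\ 0<x<\ell.$$ -/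

import Mathlib

open MeasureTheory Set

noncomputable section

/-- `u ∈ W^{1,2}(0,ℓ)`, through its continuous representative: `u` is absolutely continuous on
`[0,ℓ]` (so that its almost everywhere defined classical derivative `deriv u` is its distributional
derivative) and `u' ∈ L²(0,ℓ)`. Only the values of `u` on `[0,ℓ]` matter. -/
structure MemW12 (ℓ : ℝ) (u : ℝ → ℂ) : Prop where
  absolutelyContinuous : AbsolutelyContinuousOnInterval u 0 ℓ
  memLp_deriv : MemLp (deriv u) 2 (volume.restrict (Ioo 0 ℓ))

/-- `φ ∈ W₀^{1,2}(0,ℓ)`: elements of `W^{1,2}(0,ℓ)` that vanish at both end points. -/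
structure MemW12Zero (ℓ : ℝ) (φ : ℝ → ℂ) : Prop where
  memW12 : MemW12 ℓ φ
  left : φ 0 = 0
  right : φ ℓ = 0

/-- The norm of `W^{1,2}(0,ℓ)`. -/
def normW12 (ℓ : ℝ) (u : ℝ → ℂ) : ℝ :=
  Real.sqrt ((∫ x in (0 : ℝ)..ℓ, ‖u x‖ ^ 2) + ∫ x in (0 : ℝ)..ℓ, ‖deriv u x‖ ^ 2)

/-- `q ∈ W^{-1,2}(0,ℓ)`: `q` is a bounded linear functional on `W₀^{1,2}(0,ℓ)`. The values of `q`
at functions outside `W₀^{1,2}(0,ℓ)` are irrelevant; by linearity and boundedness, `q φ` depends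
only on `φ` restricted to `[0,ℓ]`. -/
structure IsW12ZeroDual (ℓ : ℝ) (q : (ℝ → ℂ) → ℂ) : Prop where
  map_add : ∀ φ ψ : ℝ → ℂ, MemW12Zero ℓ φ → MemW12Zero ℓ ψ →
    q (fun x => φ x + ψ x) = q φ + q ψ
  map_smul : ∀ (c : ℂ) (φ : ℝ → ℂ), MemW12Zero ℓ φ → q (fun x => c * φ x) = c * q φ
  bounded : ∃ C : ℝ, ∀ φ : ℝ → ℂ, MemW12Zero ℓ φ → ‖q φ‖ ≤ C * normW12 ℓ φ

/-- The distribution `S_q y = -y'' + q y`, for `y ∈ W^{1,2}(0,ℓ)`, tested against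
`φ ∈ W₀^{1,2}(0,ℓ)`: `(S_q y | φ) = ∫ y' φ' + (q | y φ)`. -/
def schrodingerPairing (ℓ : ℝ) (q : (ℝ → ℂ) → ℂ) (y φ : ℝ → ℂ) : ℂ :=
  (∫ x in (0 : ℝ)..ℓ, deriv y x * deriv φ x) + q (fun x => y x * φ x)

/-- `y ∈ W^{1,2}(0,ℓ)` solves `-y'' + q y = μ y` in the sense of distributions. -/
structure IsSchrodingerSolution (ℓ : ℝ) (q : (ℝ → ℂ) → ℂ) (μ : ℂ) (y : ℝ → ℂ) : Prop where
  memW12 : MemW12 ℓ y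
  equation : ∀ φ : ℝ → ℂ, MemW12Zero ℓ φ →
    schrodingerPairing ℓ q y φ = μ * ∫ x in (0 : ℝ)..ℓ, y x * φ x

/-- `f` is a nonvanishing solution of `-f'' + q f = 0` on `[0,ℓ]`, normalized by `f 0 = 1`. -/
structure IsNonvanishingSolution (ℓ : ℝ) (q : (ℝ → ℂ) → ℂ) (f : ℝ → ℂ) : Prop where
  solution : IsSchrodingerSolution ℓ q 0 f
  ne_zero : ∀ x ∈ Icc 0 ℓ, f x ≠ 0
  normalized : f 0 = 1

/-- `D_f y = y' - (f' / f) y`, defined almost everywhere on `(0,ℓ)`. -/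
def darbouxD (f y : ℝ → ℂ) (x : ℝ) : ℂ := deriv y x - deriv f x / f x * y x

/-- `e` is the solution `e_f(ρ, ·)` of `-e'' + q e = ρ² e` on `(0,ℓ)` with `e 0 = 1` and
`D_f e 0 = i ρ`. As `D_f e` is only an almost everywhere class, its value at `0` is that of its
continuous representative. -/
structure IsExponentialSolution (ℓ : ℝ) (q : (ℝ → ℂ) → ℂ) (f : ℝ → ℂ) (ρ : ℂ) (e : ℝ → ℂ) :
    Prop where
  solution : IsSchrodingerSolution ℓ q (ρ ^ 2) e
  initial : e 0 = 1
  initial_D : ∃ w : ℝ → ℂ, ContinuousOn w (Icc 0 ℓ) ∧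
    w =ᵐ[volume.restrict (Ioo 0 ℓ)] darbouxD f e ∧ w 0 = Complex.I * ρ

/-- The right inverse `R_f g (x) = f(x) ∫_0^x f(t)⁻² (∫_0^t f(s) g(s) ds) dt`. -/
def rightInverse (f g : ℝ → ℂ) (x : ℝ) : ℂ :=
  f x * ∫ t in (0 : ℝ)..x, 1 / f t ^ 2 * ∫ s in (0 : ℝ)..t, f s * g s

/-- The formal powers `φ_f^{(k)}` associated with `f`. -/
def formalPower (f : ℝ → ℂ) : ℕ → ℝ → ℂ
  | 0 => f
  | 1 => fun x => f x * ∫ t in (0 : ℝ)..x, 1 / f t ^ 2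
  | k + 2 => fun x => ((k : ℂ) + 2) * ((k : ℂ) + 1) * rightInverse f (formalPower f k) x

/-- The closed triangle `0 ≤ x ≤ ℓ`, `|t| ≤ x`. -/
def triangle (ℓ : ℝ) : Set (ℝ × ℝ) := {p | 0 ≤ p.1 ∧ p.1 ≤ ℓ ∧ |p.2| ≤ p.1}

/-- The integral operator `u ↦ u(x) + ∫_{-x}^x K(x,t) u(t) dt`. -/
def transmutation (K : ℝ → ℝ → ℂ) (u : ℝ → ℂ) (x : ℝ) : ℂ :=
  u x + ∫ t in (-x)..x, K x t * u t

/-- `K` is a kernel `K_f`: it is square integrable on the triangle and represents every solution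
`e_f(ρ, ·)`, i.e. `e_f(ρ,x) = e^{iρx} + ∫_{-x}^x K(x,t) e^{iρt} dt` for `0 < x < ℓ`, the integrals
being absolutely convergent. -/
structure IsTransmutationKernel (ℓ : ℝ) (q : (ℝ → ℂ) → ℂ) (f : ℝ → ℂ) (K : ℝ → ℝ → ℂ) :
    Prop where
  memLp : MemLp (fun p : ℝ × ℝ => K p.1 p.2) 2 (volume.restrict (triangle ℓ))
  integrable : ∀ x ∈ Ioo 0 ℓ, IntervalIntegrable (K x) volume (-x) x
  representation : ∀ ρ : ℂ, ∃ e : ℝ → ℂ, IsExponentialSolution ℓ q f ρ e ∧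
    ∀ x ∈ Ioo 0 ℓ, e x = transmutation K (fun t => Complex.exp (Complex.I * ρ * t)) x

end

noncomputable section

/-! ### Absolutely continuous complex-valued functions -/

/-! Testing `S_q y` against `f ψ` and subtracting `S_q f = 0` tested against `y ψ` cancels the
distribution `q`. What is left is the Polya form `-(f² (y/f)')' = μ f y`, which involves only the
`L²` function `h = f'/f` (`schrodingerPairing_mul_eq`). Both halves of the theorem start from this
form.

Existence. With `D_f y = iρ z` the equation becomes `y' = h y + iρ z`, `z' = -h z + iρ y`. The waves
`P = (y+z)/2` and `M = (y-z)/2` satisfy `P' = iρ P + h M`, `M' = -iρ M + h P`, `P(0) = 1`, `M(0) =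
0`. In Duhamel form the factor `e^{±iρ(x-s)}` is a translation by `±(x-s)` on the Fourier side, so
`P` and `M` are obtained from kernels that solve `K₊ = A₊ K₋`, `K₋ = S + A₋ K₊`. Here `A_σ` is
`volterraShift h σ`, and `S = ½ h((x+t)/2)` is the first reflection of the free wave. `S` is no
better than `h`, but `A₊ S` is bounded because it integrates a product of two translates of `h`. On
bounded functions, in the norm weighted by `e^{lx}` with `l` large, each `A_σ` has norm at most
`1/2`. Hence `K₊ = ∑ (A₊A₋)ⁿ A₊ S` converges, and `K = K₊ + K₋` is the kernel (`kernelPlus_eq`,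
`wavePlus_eq`, `waveMinus_eq`).

Powers. Integrating the Polya form twice gives `y = f + z φ⁽¹⁾ + z² R_f y` with `z = iρ`, whence
`e_f = ∑ zᵏ φ⁽ᵏ⁾/k!` for small `z`. Expanding the exponential under the integral gives `e_f = ∑ zᵏ
T_f[xᵏ]/k!`. The coefficients of a power series are unique
(`IsTransmutationKernel.transmutation_pow`). This uses nothing about the kernel beyond its
representation property, so it holds for every such kernel. -/

theorem AbsolutelyContinuousOnInterval.lipschitzOnWith_comp {X Y : Type*} [PseudoMetricSpace X]
    [PseudoMetricSpace Y] {u : ℝ → X} {F : X → Y} {a b : ℝ} {C : NNReal}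
    (hu : AbsolutelyContinuousOnInterval u a b) (hF : LipschitzOnWith C F (u '' uIcc a b)) :
    AbsolutelyContinuousOnInterval (fun x => F (u x)) a b := by
  rw [absolutelyContinuousOnInterval_iff] at hu ⊢
  intro ε hε
  obtain ⟨δ, hδ, h⟩ := hu (ε / (C + 1)) (by positivity)
  refine ⟨δ, hδ, fun E hE hlen => ?_⟩
  calc ∑ i ∈ Finset.range E.1, dist (F (u (E.2 i).1)) (F (u (E.2 i).2))
      ≤ ∑ i ∈ Finset.range E.1, C * dist (u (E.2 i).1) (u (E.2 i).2) := by
        refine Finset.sum_le_sum fun i hi => ?_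
        exact hF.dist_le_mul _ (mem_image_of_mem _ (hE.1 i hi).1) _
          (mem_image_of_mem _ (hE.1 i hi).2)
    _ = C * ∑ i ∈ Finset.range E.1, dist (u (E.2 i).1) (u (E.2 i).2) := by
        rw [Finset.mul_sum]
    _ ≤ (C + 1) * ∑ i ∈ Finset.range E.1, dist (u (E.2 i).1) (u (E.2 i).2) := by
        refine mul_le_mul_of_nonneg_right (by simp) (Finset.sum_nonneg fun _ _ => dist_nonneg)
    _ < (C + 1) * (ε / (C + 1)) := by
        gcongr
        exact h E hE hlen
    _ = ε := by field_simp

theorem AbsolutelyContinuousOnInterval.congr {X : Type*} [PseudoMetricSpace X] {u v : ℝ → X}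
    {a b : ℝ} (hu : AbsolutelyContinuousOnInterval u a b) (h : EqOn u v (uIcc a b)) :
    AbsolutelyContinuousOnInterval v a b := by
  rw [absolutelyContinuousOnInterval_iff] at hu ⊢
  intro ε hε
  obtain ⟨δ, hδ, H⟩ := hu ε hε
  refine ⟨δ, hδ, fun E hE hlen => ?_⟩
  have := H E hE hlen
  rwa [Finset.sum_congr rfl fun i hi => by rw [h (hE.1 i hi).1, h (hE.1 i hi).2]] at this

theorem AbsolutelyContinuousOnInterval.complex_mul {u v : ℝ → ℂ} {a b : ℝ}
    (hu : AbsolutelyContinuousOnInterval u a b) (hv : AbsolutelyContinuousOnInterval v a b) :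
    AbsolutelyContinuousOnInterval (fun x => u x * v x) a b := by
  simpa only [smul_eq_mul] using hu.fun_smul hv

/-- Real and imaginary parts reduce this to real-valued primitives; the two are recombined through
the isometric embedding of `ℝ` in `ℂ`. -/
theorem absolutelyContinuousOnInterval_intervalIntegral {g : ℝ → ℂ} {a b : ℝ}
    (hg : IntervalIntegrable g volume a b) :
    AbsolutelyContinuousOnInterval (fun x => ∫ t in a..x, g t) a b := by
  have hre : IntervalIntegrable (fun t => (g t).re) volume a b := ⟨hg.1.re, hg.2.re⟩
  have him : IntervalIntegrable (fun t => (g t).im) volume a b := ⟨hg.1.im, hg.2.im⟩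
  have h1 := hre.absolutelyContinuousOnInterval_intervalIntegral (c := a) left_mem_uIcc
  have h2 := him.absolutelyContinuousOnInterval_intervalIntegral (c := a) left_mem_uIcc
  have l1 := h1.lipschitzOnWith_comp
    (Complex.isometry_ofReal.lipschitz.lipschitzOnWith (s := _))
  have l2 := (h2.lipschitzOnWith_comp
    (Complex.isometry_ofReal.lipschitz.lipschitzOnWith (s := _))).const_smul Complex.I
  refine (l1.fun_add l2).congr fun x hx => ?_
  have hx' : IntervalIntegrable g volume a x := hg.mono_set (uIcc_subset_uIcc_left hx)
  apply Complex.ext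
  · simp only [smul_eq_mul, Complex.add_re, Complex.ofReal_re, Complex.mul_re, Complex.I_re,
      Complex.I_im, Complex.ofReal_im]
    have := (Complex.reCLM).intervalIntegral_comp_comm hx'
    simp only [Complex.reCLM_apply] at this
    rw [this]; ring
  · simp only [smul_eq_mul, Complex.add_im, Complex.ofReal_im, Complex.mul_im, Complex.I_re,
      Complex.I_im, Complex.ofReal_re]
    have := (Complex.imCLM).intervalIntegral_comp_comm hx'
    simp only [Complex.imCLM_apply] at this
    rw [this]; ring

theorem AbsolutelyContinuousOnInterval.ae_hasDerivAt {u : ℝ → ℂ} {a b : ℝ}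
    (hu : AbsolutelyContinuousOnInterval u a b) :
    ∀ᵐ x : ℝ, x ∈ uIcc a b → HasDerivAt u (deriv u x) x := by
  filter_upwards [hu.boundedVariationOn.ae_differentiableAt_of_mem_uIcc] with x hx hm
  exact (hx hm).hasDerivAt

/-- An absolutely continuous function is the primitive of its integrable almost everywhere
derivative. -/
theorem AbsolutelyContinuousOnInterval.eq_add_integral {u g : ℝ → ℂ} {a b : ℝ}
    (hu : AbsolutelyContinuousOnInterval u a b) (hg : IntervalIntegrable g volume a b)
    (hd : ∀ᵐ x : ℝ, x ∈ uIcc a b → HasDerivAt u (g x) x) {x : ℝ} (hx : x ∈ uIcc a b) :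
    u x = u a + ∫ t in a..x, g t := by
  have hac := hu.fun_sub (absolutelyContinuousOnInterval_intervalIntegral hg)
  obtain ⟨C, hC⟩ := hac.const_of_ae_hasDerivAt_zero (by
    filter_upwards [hd, hg.ae_hasDerivAt_integral] with y h1 h2 hy
    have := (h1 hy).sub (h2 hy a left_mem_uIcc)
    simpa using! this)
  have e1 := hC x hx
  have e2 := hC a left_mem_uIcc
  simp only [intervalIntegral.integral_same, sub_zero] at e1 e2
  rw [e2, ← e1]; ring

/-! ### The space `W^{1,2}(0,ℓ)` -/

theorem ae_restrict_Ioo_of_ae_uIcc {ℓ : ℝ} (hℓ : 0 ≤ ℓ) {p : ℝ → Prop}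
    (h : ∀ᵐ x : ℝ, x ∈ uIcc 0 ℓ → p x) : ∀ᵐ x ∂volume.restrict (Ioo 0 ℓ), p x := by
  rw [← ae_restrict_iff' measurableSet_uIcc, uIcc_of_le hℓ, ← Measure.restrict_congr_set
    Ioo_ae_eq_Icc] at h
  exact h

theorem intervalIntegrable_iff_integrable_Ioo {ℓ : ℝ} (hℓ : 0 ≤ ℓ) {g : ℝ → ℂ} :
    IntervalIntegrable g volume 0 ℓ ↔ Integrable g (volume.restrict (Ioo 0 ℓ)) :=
  intervalIntegrable_iff_integrableOn_Ioo_of_le hℓ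

theorem intervalIntegral_eq_integral_Ioo {ℓ : ℝ} (hℓ : 0 ≤ ℓ) (g : ℝ → ℂ) :
    ∫ x in (0 : ℝ)..ℓ, g x = ∫ x in Ioo 0 ℓ, g x := by
  rw [intervalIntegral.integral_of_le hℓ, integral_Ioc_eq_integral_Ioo]

theorem MeasureTheory.MemLp.intervalIntegrable_of_two {ℓ : ℝ} (hℓ : 0 ≤ ℓ) {g : ℝ → ℂ}
    (hg : MemLp g 2 (volume.restrict (Ioo 0 ℓ))) : IntervalIntegrable g volume 0 ℓ :=
  (intervalIntegrable_iff_integrable_Ioo hℓ).2 (hg.integrable (by norm_num))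

/-- The product of an `L²` function with a function continuous on `[0,ℓ]`. -/
theorem MeasureTheory.MemLp.mul_continuousOn_Icc {ℓ : ℝ} {g u : ℝ → ℂ}
    (hg : MemLp g 2 (volume.restrict (Ioo 0 ℓ))) (hu : ContinuousOn u (Icc 0 ℓ)) :
    MemLp (fun x => u x * g x) 2 (volume.restrict (Ioo 0 ℓ)) := by
  obtain ⟨C, hC⟩ := isCompact_Icc.exists_bound_of_continuousOn hu
  have hm : AEStronglyMeasurable u (volume.restrict (Ioo 0 ℓ)) :=
    (hu.mono Ioo_subset_Icc_self).aestronglyMeasurable measurableSet_Ioo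
  refine MemLp.of_le_mul (c := C) hg (hm.mul hg.1) ?_
  filter_upwards [ae_restrict_mem measurableSet_Ioo] with x hx
  rw [norm_mul]
  gcongr
  exact hC x (Ioo_subset_Icc_self hx)

theorem ContinuousOn.memLp_Ioo {ℓ : ℝ} {u : ℝ → ℂ} (hu : ContinuousOn u (Icc 0 ℓ)) :
    MemLp u 2 (volume.restrict (Ioo 0 ℓ)) := by
  obtain ⟨C, hC⟩ := isCompact_Icc.exists_bound_of_continuousOn hu
  refine MemLp.of_bound ((hu.mono Ioo_subset_Icc_self).aestronglyMeasurable measurableSet_Ioo)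
    C ?_
  filter_upwards [ae_restrict_mem measurableSet_Ioo] with x hx
  exact hC x (Ioo_subset_Icc_self hx)

theorem continuousOn_intervalIntegral_Icc {ℓ : ℝ} {g : ℝ → ℂ} (hℓ : 0 ≤ ℓ)
    (hg : IntervalIntegrable g volume 0 ℓ) :
    ContinuousOn (fun x => ∫ t in (0 : ℝ)..x, g t) (Icc 0 ℓ) := by
  have := (absolutelyContinuousOnInterval_intervalIntegral hg).continuousOn
  rwa [uIcc_of_le hℓ] at this

namespace MemW12

variable {ℓ : ℝ} {y z : ℝ → ℂ}

theorem of_eq_add_integral (hℓ : 0 ≤ ℓ) {g : ℝ → ℂ} {c : ℂ}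
    (hg : MemLp g 2 (volume.restrict (Ioo 0 ℓ)))
    (hy : ∀ x ∈ Icc 0 ℓ, y x = c + ∫ t in (0 : ℝ)..x, g t) :
    MemW12 ℓ y ∧ deriv y =ᵐ[volume.restrict (Ioo 0 ℓ)] g := by
  have hgi := hg.intervalIntegrable_of_two hℓ
  have hac : AbsolutelyContinuousOnInterval y 0 ℓ := by
    refine (((LipschitzWith.const c).lipschitzOnWith.absolutelyContinuousOnInterval).fun_add
      (absolutelyContinuousOnInterval_intervalIntegral hgi)).congr fun x hx => ?_
    rw [uIcc_of_le hℓ] at hx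
    exact (hy x hx).symm
  have hd : deriv y =ᵐ[volume.restrict (Ioo 0 ℓ)] g := by
    filter_upwards [ae_restrict_Ioo_of_ae_uIcc hℓ hgi.ae_hasDerivAt_integral,
      ae_restrict_mem measurableSet_Ioo] with x hx hm
    have h0 : (0 : ℝ) ∈ uIcc 0 ℓ := left_mem_uIcc
    have := (hx 0 h0).const_add c
    refine (this.congr_of_eventuallyEq ?_).deriv
    filter_upwards [isOpen_Ioo.mem_nhds hm] with t ht
    exact hy t (Ioo_subset_Icc_self ht)
  exact ⟨⟨hac, hg.ae_eq hd.symm⟩, hd⟩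

theorem of_ae_hasDerivAt {g : ℝ → ℂ}
    (hac : AbsolutelyContinuousOnInterval y 0 ℓ)
    (hg : MemLp g 2 (volume.restrict (Ioo 0 ℓ)))
    (hd : ∀ᵐ x ∂volume.restrict (Ioo 0 ℓ), HasDerivAt y (g x) x) :
    MemW12 ℓ y ∧ deriv y =ᵐ[volume.restrict (Ioo 0 ℓ)] g := by
  have : deriv y =ᵐ[volume.restrict (Ioo 0 ℓ)] g := hd.mono fun x hx => hx.deriv
  exact ⟨⟨hac, hg.ae_eq this.symm⟩, this⟩

theorem ae_hasDerivAt (hℓ : 0 ≤ ℓ) (hy : MemW12 ℓ y) :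
    ∀ᵐ x ∂volume.restrict (Ioo 0 ℓ), HasDerivAt y (deriv y x) x :=
  ae_restrict_Ioo_of_ae_uIcc hℓ hy.absolutelyContinuous.ae_hasDerivAt

theorem continuousOn (hℓ : 0 ≤ ℓ) (hy : MemW12 ℓ y) : ContinuousOn y (Icc 0 ℓ) := by
  have := hy.absolutelyContinuous.continuousOn
  rwa [uIcc_of_le hℓ] at this

theorem eq_add_integral (hℓ : 0 ≤ ℓ) (hy : MemW12 ℓ y) {x : ℝ} (hx : x ∈ Icc 0 ℓ) :
    y x = y 0 + ∫ t in (0 : ℝ)..x, deriv y t :=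
  hy.absolutelyContinuous.eq_add_integral (hy.memLp_deriv.intervalIntegrable_of_two hℓ)
    hy.absolutelyContinuous.ae_hasDerivAt (by rwa [uIcc_of_le hℓ])

theorem mul (hℓ : 0 ≤ ℓ) (hy : MemW12 ℓ y) (hz : MemW12 ℓ z) :
    MemW12 ℓ (fun x => y x * z x) ∧ deriv (fun x => y x * z x)
      =ᵐ[volume.restrict (Ioo 0 ℓ)] fun x => deriv y x * z x + y x * deriv z x := by
  refine of_ae_hasDerivAt (hy.absolutelyContinuous.complex_mul hz.absolutelyContinuous) ?_ ?_
  · have h1 := hy.memLp_deriv.mul_continuousOn_Icc (hz.continuousOn hℓ)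
    have h2 := hz.memLp_deriv.mul_continuousOn_Icc (hy.continuousOn hℓ)
    refine (h1.add h2).ae_eq (Filter.Eventually.of_forall fun x => ?_)
    simp only [Pi.add_apply]; ring
  · filter_upwards [hy.ae_hasDerivAt hℓ, hz.ae_hasDerivAt hℓ] with x h1 h2
    exact h1.mul h2

theorem inv (hℓ : 0 ≤ ℓ) (hy : MemW12 ℓ y) (h0 : ∀ x ∈ Icc 0 ℓ, y x ≠ 0) :
    MemW12 ℓ (fun x => (y x)⁻¹) ∧ deriv (fun x => (y x)⁻¹)
      =ᵐ[volume.restrict (Ioo 0 ℓ)] fun x => -deriv y x / y x ^ 2 := by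
  have hc := hy.continuousOn hℓ
  have hci : ContinuousOn (fun x => (y x)⁻¹) (Icc 0 ℓ) := hc.inv₀ h0
  obtain ⟨C, hC⟩ := isCompact_Icc.exists_bound_of_continuousOn hci
  -- `|1/a - 1/b| = |a - b| / (|a| |b|)`, and `C` bounds the inverses on the image of `y`.
  have hL : LipschitzOnWith (Real.toNNReal (C ^ 2)) (fun w : ℂ => w⁻¹) (y '' uIcc 0 ℓ) := by
    rw [uIcc_of_le hℓ]
    refine LipschitzOnWith.of_dist_le_mul ?_
    rintro _ ⟨s, hs, rfl⟩ _ ⟨t, ht, rfl⟩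
    rw [Real.coe_toNNReal _ (by positivity), dist_eq_norm, dist_eq_norm,
      inv_sub_inv (h0 s hs) (h0 t ht), div_eq_mul_inv, mul_inv, norm_mul, norm_mul,
      norm_sub_rev, mul_comm, sq]
    have := hC s hs
    have := hC t ht
    have : 0 ≤ C := (norm_nonneg _).trans this
    gcongr
  refine of_ae_hasDerivAt (hy.absolutelyContinuous.lipschitzOnWith_comp hL) ?_ ?_
  · have := hy.memLp_deriv.mul_continuousOn_Icc ((hci.pow 2).neg)
    refine this.ae_eq (Filter.Eventually.of_forall fun x => ?_)
    simp only [Pi.neg_apply, Pi.pow_apply, div_eq_mul_inv]; ring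
  · filter_upwards [hy.ae_hasDerivAt hℓ, ae_restrict_mem measurableSet_Ioo] with x h1 hx
    exact h1.inv (h0 x (Ioo_subset_Icc_self hx))

theorem integral_deriv_mul_add (hℓ : 0 ≤ ℓ) (hy : MemW12 ℓ y) (hz : MemW12 ℓ z) :
    ∫ x in (0 : ℝ)..ℓ, (deriv y x * z x + y x * deriv z x) = y ℓ * z ℓ - y 0 * z 0 := by
  obtain ⟨h, hd⟩ := hy.mul hℓ hz
  have e := h.eq_add_integral hℓ (right_mem_Icc.2 hℓ)
  rw [eq_comm, sub_eq_iff_eq_add', e]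
  congr 1
  rw [intervalIntegral_eq_integral_Ioo hℓ, intervalIntegral_eq_integral_Ioo hℓ]
  exact integral_congr_ae hd

theorem intervalIntegrable_deriv_mul (hℓ : 0 ≤ ℓ) (hy : MemW12 ℓ y) {u : ℝ → ℂ}
    (hu : ContinuousOn u (Icc 0 ℓ)) :
    IntervalIntegrable (fun x => deriv y x * u x) volume 0 ℓ := by
  have := (hy.memLp_deriv.mul_continuousOn_Icc hu).intervalIntegrable_of_two hℓ
  simpa only [mul_comm] using this

end MemW12

/-- The lemma of du Bois-Reymond in `L²`. -/
theorem ae_eq_const_of_integral_mul_deriv_eq_zero {ℓ : ℝ} (hℓ : 0 < ℓ) {G : ℝ → ℂ}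
    (hG : MemLp G 2 (volume.restrict (Ioo 0 ℓ)))
    (h : ∀ ψ : ℝ → ℂ, MemW12Zero ℓ ψ → ∫ x in (0 : ℝ)..ℓ, G x * deriv ψ x = 0) :
    ∃ c : ℂ, G =ᵐ[volume.restrict (Ioo 0 ℓ)] fun _ => c := by
  -- Subtracting the mean `c` makes the primitive of `conj (G - c)` vanish at both ends, hence
  -- admissible as a test function. The conjugate turns the resulting identity into `∫ |G - c|² =
  -- 0`.
  set c : ℂ := (∫ x in (0 : ℝ)..ℓ, G x) / ℓ with hc
  have hℓ' : (ℓ : ℂ) ≠ 0 := by exact_mod_cast hℓ.ne'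
  set g : ℝ → ℂ := fun x => (starRingEnd ℂ) (G x - c) with hg
  have hcm : MemLp (fun _ : ℝ => c) 2 (volume.restrict (Ioo 0 ℓ)) := memLp_const c
  have hGc : MemLp (fun x => G x - c) 2 (volume.restrict (Ioo 0 ℓ)) := hG.sub hcm
  have hgm : MemLp g 2 (volume.restrict (Ioo 0 ℓ)) := hGc.star
  have hint : ∫ x in (0 : ℝ)..ℓ, g x = 0 := by
    have h1 : ∫ x in (0 : ℝ)..ℓ, (G x - c) = 0 := by
      rw [intervalIntegral.integral_sub (hG.intervalIntegrable_of_two hℓ.le)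
        intervalIntegrable_const, intervalIntegral.integral_const, hc]
      simp only [sub_zero, Complex.real_smul]
      field_simp; simp
    rw [intervalIntegral_eq_integral_Ioo hℓ.le] at h1 ⊢
    rw [hg, integral_conj, h1, map_zero]
  obtain ⟨hψ, hd⟩ := MemW12.of_eq_add_integral (y := fun x => ∫ t in (0 : ℝ)..x, g t) (c := 0)
    hℓ.le hgm (by simp)
  have key := h _ ⟨hψ, by simp, hint⟩
  rw [intervalIntegral_eq_integral_Ioo hℓ.le, integral_congr_ae
    (g := fun x => G x * g x) (hd.mono fun x hx => by simp only [hx])] at key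
  have hGg : Integrable (fun x => G x * g x) (volume.restrict (Ioo 0 ℓ)) :=
    hG.integrable_mul hgm
  have hcg : Integrable (fun x => c * g x) (volume.restrict (Ioo 0 ℓ)) :=
    hcm.integrable_mul hgm
  have key2 : ∫ x in Ioo 0 ℓ, (G x * g x - c * g x) = 0 := by
    rw [integral_sub hGg hcg, key, integral_const_mul, ← intervalIntegral_eq_integral_Ioo hℓ.le,
      hint]
    simp
  have e : ∀ x, G x * g x - c * g x = ((‖G x - c‖ ^ 2 : ℝ) : ℂ) := by
    intro x
    rw [← sub_mul, hg, Complex.mul_conj, Complex.normSq_eq_norm_sq]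
  simp_rw [e] at key2
  rw [integral_complex_ofReal] at key2
  have key3 : ∫ x in Ioo 0 ℓ, ‖G x - c‖ ^ 2 = 0 := by exact_mod_cast key2
  rw [integral_eq_zero_iff_of_nonneg (fun x => by positivity) hGc.norm.integrable_sq] at key3
  refine ⟨c, key3.mono fun x hx => ?_⟩
  simpa [sub_eq_zero] using hx

/-! ### The Polya factorization of the distributional Schrödinger operator -/

section Factorization

variable {ℓ : ℝ} {q : (ℝ → ℂ) → ℂ} {f : ℝ → ℂ}

/-- A functional on `W₀^{1,2}(0,ℓ)` only depends on the values in `[0,ℓ]`. -/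
theorem IsW12ZeroDual.congr (hℓ : 0 ≤ ℓ) (hq : IsW12ZeroDual ℓ q) {φ ψ : ℝ → ℂ}
    (hψ : MemW12Zero ℓ ψ) (h : EqOn φ ψ (Icc 0 ℓ)) : q φ = q ψ := by
  -- The difference is the primitive of `0` on `[0,ℓ]`, so its `W^{1,2}` norm is zero and
  -- boundedness of `q` annihilates it.
  obtain ⟨hd, hd'⟩ := MemW12.of_eq_add_integral (y := fun x => φ x - ψ x) (g := fun _ => 0) (c := 0)
    hℓ (memLp_const 0) (fun x hx => by simp [h hx])
  have hd0 : MemW12Zero ℓ (fun x => φ x - ψ x) :=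
    ⟨hd, by simp [h (left_mem_Icc.2 hℓ)], by simp [h (right_mem_Icc.2 hℓ)]⟩
  have hn : normW12 ℓ (fun x => φ x - ψ x) = 0 := by
    have h1 : ∫ x in (0 : ℝ)..ℓ, ‖φ x - ψ x‖ ^ 2 = 0 := by
      rw [intervalIntegral.integral_congr (g := fun _ => 0)]
      · simp
      · intro x hx
        rw [uIcc_of_le hℓ] at hx
        simp [h hx]
    have h2 : ∫ x in (0 : ℝ)..ℓ, ‖deriv (fun x => φ x - ψ x) x‖ ^ 2 = 0 := by
      rw [intervalIntegral.integral_of_le hℓ, integral_Ioc_eq_integral_Ioo,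
        integral_congr_ae (g := fun _ => (0 : ℝ)) (hd'.mono fun x hx => by simp [hx])]
      simp
    simp only [normW12, h1, h2, add_zero, Real.sqrt_zero]
  obtain ⟨C, hC⟩ := hq.bounded
  have h0 : q (fun x => φ x - ψ x) = 0 := by
    have := hC _ hd0
    rw [hn, mul_zero] at this
    exact norm_le_zero_iff.1 this
  have := hq.map_add ψ _ hψ hd0
  rw [h0, add_zero] at this
  rw [← this]
  congr 1
  funext x
  ring

theorem MemW12Zero.mul_left (hℓ : 0 ≤ ℓ) {y φ : ℝ → ℂ} (hy : MemW12 ℓ y)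
    (hφ : MemW12Zero ℓ φ) : MemW12Zero ℓ (fun x => y x * φ x) :=
  ⟨(hy.mul hℓ hφ.memW12).1, by simp [hφ.left], by simp [hφ.right]⟩

/-- `(S_q y | f ψ) = ∫ (f y' - f' y) ψ'` whenever `S_q f = 0`. -/
theorem schrodingerPairing_mul_eq (hℓ : 0 ≤ ℓ) (hf : IsSchrodingerSolution ℓ q 0 f)
    {y ψ : ℝ → ℂ} (hy : MemW12 ℓ y) (hψ : MemW12Zero ℓ ψ) :
    schrodingerPairing ℓ q y (fun x => f x * ψ x) =
      ∫ x in (0 : ℝ)..ℓ, (f x * deriv y x - deriv f x * y x) * deriv ψ x := by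
  have hfW := hf.memW12
  have h1 := hf.equation _ (hψ.mul_left hℓ hy)
  obtain ⟨hfψ, dfψ⟩ := hfW.mul hℓ hψ.memW12
  obtain ⟨hyψ, dyψ⟩ := hy.mul hℓ hψ.memW12
  have hfc := hfW.continuousOn hℓ
  have hyc := hy.continuousOn hℓ
  have hψc := hψ.memW12.continuousOn hℓ
  simp only [schrodingerPairing, zero_mul] at h1 ⊢
  have hq : q (fun x => y x * (f x * ψ x)) = q (fun x => f x * (y x * ψ x)) := by
    congr 1
    funext x
    ring
  -- The zero subtracted is `S_q f` tested against `y ψ`; its `q`-term is the same `q(f y ψ)`, so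
  -- only the classical integrals survive.
  rw [hq, ← sub_zero (_ + _), ← h1, add_sub_add_right_eq_sub]
  have i1 : Integrable (fun x => deriv y x * deriv (fun x => f x * ψ x) x)
      (volume.restrict (Ioo 0 ℓ)) := hy.memLp_deriv.integrable_mul hfψ.memLp_deriv
  have i2 : Integrable (fun x => deriv f x * deriv (fun x => y x * ψ x) x)
      (volume.restrict (Ioo 0 ℓ)) := hfW.memLp_deriv.integrable_mul hyψ.memLp_deriv
  rw [intervalIntegral_eq_integral_Ioo hℓ, intervalIntegral_eq_integral_Ioo hℓ,
    intervalIntegral_eq_integral_Ioo hℓ, ← integral_sub i1 i2]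
  refine integral_congr_ae ?_
  filter_upwards [dfψ, dyψ] with x e1 e2
  rw [e1, e2]
  ring

/-- A solution of `S_q y = μ y` satisfies `-(f² (y/f)')' = μ f y` in the sense of
distributions. -/
theorem IsSchrodingerSolution.integral_wronskian_mul_deriv (hℓ : 0 ≤ ℓ)
    (hf : IsSchrodingerSolution ℓ q 0 f) {μ : ℂ} {y : ℝ → ℂ} (hy : IsSchrodingerSolution ℓ q μ y)
    {ψ : ℝ → ℂ} (hψ : MemW12Zero ℓ ψ) :
    ∫ x in (0 : ℝ)..ℓ, (f x * deriv y x - deriv f x * y x) * deriv ψ x =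
      μ * ∫ x in (0 : ℝ)..ℓ, f x * y x * ψ x := by
  rw [← schrodingerPairing_mul_eq hℓ hf hy.memW12 hψ,
    hy.equation _ (hψ.mul_left hℓ hf.memW12)]
  congr 2
  funext x
  ring

/-- Since `f` has no zeros, `φ/f` is again a test function for every test function `φ`. The Polya
form therefore recovers the full weak equation. -/
theorem IsNonvanishingSolution.isSchrodingerSolution_of_integral (hℓ : 0 ≤ ℓ)
    (hq : IsW12ZeroDual ℓ q) (hf : IsNonvanishingSolution ℓ q f) {μ : ℂ} {y : ℝ → ℂ}
    (hy : MemW12 ℓ y)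
    (h : ∀ ψ : ℝ → ℂ, MemW12Zero ℓ ψ →
      ∫ x in (0 : ℝ)..ℓ, (f x * deriv y x - deriv f x * y x) * deriv ψ x =
        μ * ∫ x in (0 : ℝ)..ℓ, f x * y x * ψ x) :
    IsSchrodingerSolution ℓ q μ y := by
  refine ⟨hy, fun φ hφ => ?_⟩
  have hfW := hf.solution.memW12
  have hψ : MemW12Zero ℓ (fun x => (f x)⁻¹ * φ x) := hφ.mul_left hℓ (hfW.inv hℓ hf.ne_zero).1
  have e : EqOn φ (fun x => f x * ((f x)⁻¹ * φ x)) (Icc 0 ℓ) := fun x hx => by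
    simp only [mul_inv_cancel_left₀ (hf.ne_zero x hx)]
  have hfψ := hψ.mul_left hℓ hfW
  have h1 : schrodingerPairing ℓ q y φ =
      schrodingerPairing ℓ q y (fun x => f x * ((f x)⁻¹ * φ x)) := by
    simp only [schrodingerPairing]
    congr 1
    · rw [intervalIntegral_eq_integral_Ioo hℓ, intervalIntegral_eq_integral_Ioo hℓ]
      refine setIntegral_congr_fun measurableSet_Ioo fun x hx => ?_
      congr 1
      refine Filter.EventuallyEq.deriv_eq ?_
      filter_upwards [isOpen_Ioo.mem_nhds hx] with t ht using e (Ioo_subset_Icc_self ht)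
    · refine hq.congr hℓ (hfψ.mul_left hℓ hy) fun x hx => ?_
      exact congrArg (y x * ·) (e hx)
  rw [h1, schrodingerPairing_mul_eq hℓ hf.solution hy hψ, h _ hψ]
  congr 1
  refine intervalIntegral.integral_congr fun x hx => ?_
  rw [uIcc_of_le hℓ] at hx
  have := hf.ne_zero x hx
  field_simp

/-- The solutions `e_f(ρ,·)` satisfy a Volterra integral equation whose coefficients are the
formal powers. -/
theorem IsExponentialSolution.eq_add_rightInverse (hℓ : 0 < ℓ)
    (hf : IsNonvanishingSolution ℓ q f) {ρ : ℂ} {y : ℝ → ℂ}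
    (hy : IsExponentialSolution ℓ q f ρ y) {x : ℝ} (hx : x ∈ Icc 0 ℓ) :
    y x = f x + Complex.I * ρ * formalPower f 1 x + (Complex.I * ρ) ^ 2 * rightInverse f y x := by
  obtain ⟨w, hwc, hwe, hw0⟩ := hy.initial_D
  have hfW := hf.solution.memW12
  have hyW := hy.solution.memW12
  have hfc := hfW.continuousOn hℓ.le
  have hyc := hyW.continuousOn hℓ.le
  have hfyc : ContinuousOn (fun x => f x * y x) (Icc 0 ℓ) := hfc.mul hyc
  set Y : ℝ → ℂ := fun x => ∫ t in (0 : ℝ)..x, f t * y t with hY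
  obtain ⟨hYW, hYd⟩ := MemW12.of_eq_add_integral (y := Y) (c := 0) hℓ.le hfyc.memLp_Ioo
    (by simp [hY])
  have hYc := hYW.continuousOn hℓ.le
  have hfw : ContinuousOn (fun x => f x * w x) (Icc 0 ℓ) := hfc.mul hwc
  -- the quasi-derivative
  have hW : (fun x => f x * deriv y x - deriv f x * y x)
      =ᵐ[volume.restrict (Ioo 0 ℓ)] fun x => f x * w x := by
    filter_upwards [hwe, ae_restrict_mem measurableSet_Ioo] with x h1 hx
    have := hf.ne_zero x (Ioo_subset_Icc_self hx)
    rw [h1, darbouxD]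
    field_simp
  have hGc : ContinuousOn (fun x => f x * w x + ρ ^ 2 * Y x) (Icc 0 ℓ) :=
    hfw.add (continuousOn_const.mul hYc)
  -- The Polya form says that `f w + ρ² Y` has zero weak derivative, where `Y` is the primitive of
  -- `f y`. Continuity extends the resulting constancy to all of `[0,ℓ]`, and the value at `0`
  -- identifies the constant as `iρ`.
  obtain ⟨c, hc⟩ := ae_eq_const_of_integral_mul_deriv_eq_zero hℓ hGc.memLp_Ioo (by
    intro ψ hψ
    have h1 := IsSchrodingerSolution.integral_wronskian_mul_deriv hℓ.le hf.solution hy.solution hψ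
    have h2 := hYW.integral_deriv_mul_add hℓ.le hψ.memW12
    rw [hψ.left, hψ.right, mul_zero, mul_zero, sub_zero] at h2
    have i1 : IntervalIntegrable (fun x => f x * w x * deriv ψ x) volume 0 ℓ := by
      simpa only [mul_comm] using hψ.memW12.intervalIntegrable_deriv_mul hℓ.le hfw
    have i2 : IntervalIntegrable (fun x => Y x * deriv ψ x) volume 0 ℓ := by
      simpa only [mul_comm] using hψ.memW12.intervalIntegrable_deriv_mul hℓ.le hYc
    have i3 : IntervalIntegrable (fun x => deriv Y x * ψ x) volume 0 ℓ :=
      hYW.intervalIntegrable_deriv_mul hℓ.le (hψ.memW12.continuousOn hℓ.le)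
    rw [intervalIntegral.integral_add i3 i2] at h2
    have h3 : ∫ x in (0 : ℝ)..ℓ, deriv Y x * ψ x = ∫ x in (0 : ℝ)..ℓ, f x * y x * ψ x := by
      rw [intervalIntegral_eq_integral_Ioo hℓ.le, intervalIntegral_eq_integral_Ioo hℓ.le]
      exact integral_congr_ae (hYd.mono fun x hx => by simp only [hx])
    have h4 : ∫ x in (0 : ℝ)..ℓ, (f x * deriv y x - deriv f x * y x) * deriv ψ x =
        ∫ x in (0 : ℝ)..ℓ, f x * w x * deriv ψ x := by
      rw [intervalIntegral_eq_integral_Ioo hℓ.le, intervalIntegral_eq_integral_Ioo hℓ.le]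
      exact integral_congr_ae (hW.mono fun x hx => by simp only [hx])
    have h5 : ∀ x, (f x * w x + ρ ^ 2 * Y x) * deriv ψ x =
        f x * w x * deriv ψ x + ρ ^ 2 * (Y x * deriv ψ x) := fun x => by ring
    simp_rw [h5]
    rw [intervalIntegral.integral_add i1 (i2.const_mul _), intervalIntegral.integral_const_mul,
      ← h4, h1, ← mul_add, ← h3, h2, mul_zero])
  have hc' : EqOn (fun x => f x * w x + ρ ^ 2 * Y x) (fun _ => c) (Icc 0 ℓ) := by
    rw [Measure.restrict_congr_set Ioo_ae_eq_Icc] at hc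
    exact Measure.eqOn_Icc_of_ae_eq volume hℓ.ne hc hGc continuousOn_const
  have hcv : c = Complex.I * ρ := by
    have := hc' (left_mem_Icc.2 hℓ.le)
    simpa [hY, hf.normalized, hw0] using this.symm
  have hw : ∀ t ∈ Icc 0 ℓ, f t * w t = Complex.I * ρ - ρ ^ 2 * Y t := fun t ht => by
    rw [← hcv]; exact eq_sub_of_add_eq (hc' ht)
  -- the quotient
  obtain ⟨hiW, hid⟩ := hfW.inv hℓ.le hf.ne_zero
  obtain ⟨hqW, hqd⟩ := hyW.mul hℓ.le hiW
  have hfi2 : ContinuousOn (fun t => 1 / f t ^ 2) (Icc 0 ℓ) :=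
    continuousOn_const.div (hfc.pow 2) fun t ht => pow_ne_zero _ (hf.ne_zero t ht)
  have hsub : uIcc 0 x ⊆ Icc 0 ℓ := by
    rw [uIcc_of_le hx.1]; exact Icc_subset_Icc_right hx.2
  have e := hqW.eq_add_integral hℓ.le hx
  have e2 : ∫ t in (0 : ℝ)..x, deriv (fun x => y x * (f x)⁻¹) t =
      ∫ t in (0 : ℝ)..x, (Complex.I * ρ * (1 / f t ^ 2) - ρ ^ 2 * (1 / f t ^ 2 * Y t)) := by
    rw [intervalIntegral_eq_integral_Ioo hx.1, intervalIntegral_eq_integral_Ioo hx.1]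
    refine integral_congr_ae ?_
    have hsub' : Ioo 0 x ⊆ Ioo 0 ℓ := Ioo_subset_Ioo_right hx.2
    filter_upwards [ae_restrict_of_ae_restrict_of_subset hsub' hqd,
      ae_restrict_of_ae_restrict_of_subset hsub' hid,
      ae_restrict_of_ae_restrict_of_subset hsub' hW, ae_restrict_mem measurableSet_Ioo]
      with t h1 h2 h3 ht
    have htI : t ∈ Icc 0 ℓ := Ioo_subset_Icc_self (hsub' ht)
    have hft := hf.ne_zero t htI
    have h4 := hw t htI
    rw [h1, h2]
    rw [h4] at h3
    have : deriv y t * (f t)⁻¹ + y t * (-deriv f t / f t ^ 2) =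
        (f t * deriv y t - deriv f t * y t) / f t ^ 2 := by field_simp; ring
    rw [this, h3]
    ring
  have j1 : IntervalIntegrable (fun t => 1 / f t ^ 2) volume 0 x :=
    (hfi2.mono hsub).intervalIntegrable
  have j2 : IntervalIntegrable (fun t => 1 / f t ^ 2 * Y t) volume 0 x :=
    ((hfi2.mul hYc).mono hsub).intervalIntegrable
  rw [e2, intervalIntegral.integral_sub (j1.const_mul _) (j2.const_mul _),
    intervalIntegral.integral_const_mul, intervalIntegral.integral_const_mul, hy.initial,
    hf.normalized] at e
  have hfx := hf.ne_zero x hx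
  have e3 : y x = f x * (y x * (f x)⁻¹) := by field_simp
  rw [e3, e]
  simp only [formalPower, rightInverse, hY, mul_pow, Complex.I_sq]
  ring

end Factorization

/-! ### Expansion in formal powers -/

section FormalPowers

variable {ℓ : ℝ} {f : ℝ → ℂ}

theorem continuousOn_one_div_sq (hfc : ContinuousOn f (Icc 0 ℓ)) (h0 : ∀ x ∈ Icc 0 ℓ, f x ≠ 0) :
    ContinuousOn (fun t => 1 / f t ^ 2) (Icc 0 ℓ) :=
  continuousOn_const.div (hfc.pow 2) fun t ht => pow_ne_zero _ (h0 t ht)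

theorem continuousOn_primitive_mul (hℓ : 0 ≤ ℓ) (hfc : ContinuousOn f (Icc 0 ℓ)) {g : ℝ → ℂ}
    (hg : ContinuousOn g (Icc 0 ℓ)) :
    ContinuousOn (fun t => ∫ s in (0 : ℝ)..t, f s * g s) (Icc 0 ℓ) :=
  continuousOn_intervalIntegral_Icc hℓ ((hfc.mul hg).intervalIntegrable_of_Icc hℓ)

theorem continuousOn_rightInverse (hℓ : 0 ≤ ℓ) (hfc : ContinuousOn f (Icc 0 ℓ))
    (h0 : ∀ x ∈ Icc 0 ℓ, f x ≠ 0) {g : ℝ → ℂ} (hg : ContinuousOn g (Icc 0 ℓ)) :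
    ContinuousOn (rightInverse f g) (Icc 0 ℓ) :=
  hfc.mul (continuousOn_intervalIntegral_Icc hℓ
    (((continuousOn_one_div_sq hfc h0).mul
      (continuousOn_primitive_mul hℓ hfc hg)).intervalIntegrable_of_Icc hℓ))

theorem continuousOn_formalPower (hℓ : 0 ≤ ℓ) (hfc : ContinuousOn f (Icc 0 ℓ))
    (h0 : ∀ x ∈ Icc 0 ℓ, f x ≠ 0) : ∀ k, ContinuousOn (formalPower f k) (Icc 0 ℓ)
  | 0 => hfc
  | 1 => hfc.mul (continuousOn_intervalIntegral_Icc hℓ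
      ((continuousOn_one_div_sq hfc h0).intervalIntegrable_of_Icc hℓ))
  | k + 2 => continuousOn_const.mul
      (continuousOn_rightInverse hℓ hfc h0 (continuousOn_formalPower hℓ hfc h0 k))

theorem rightInverse_add (hℓ : 0 ≤ ℓ) (hfc : ContinuousOn f (Icc 0 ℓ))
    (h0 : ∀ x ∈ Icc 0 ℓ, f x ≠ 0) {g k : ℝ → ℂ} (hg : ContinuousOn g (Icc 0 ℓ))
    (hk : ContinuousOn k (Icc 0 ℓ)) {x : ℝ} (hx : x ∈ Icc 0 ℓ) :
    rightInverse f (fun s => g s + k s) x = rightInverse f g x + rightInverse f k x := by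
  have hsub : ∀ {t}, t ∈ Icc 0 ℓ → uIcc 0 t ⊆ Icc 0 ℓ := fun {t} ht => by
    rw [uIcc_of_le ht.1]; exact Icc_subset_Icc_right ht.2
  have hi := continuousOn_one_div_sq hfc h0
  have i1 : IntervalIntegrable (fun t => 1 / f t ^ 2 * ∫ s in (0 : ℝ)..t, f s * g s) volume 0 x :=
    ((hi.mul (continuousOn_primitive_mul hℓ hfc hg)).mono (hsub hx)).intervalIntegrable
  have i2 : IntervalIntegrable (fun t => 1 / f t ^ 2 * ∫ s in (0 : ℝ)..t, f s * k s) volume 0 x :=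
    ((hi.mul (continuousOn_primitive_mul hℓ hfc hk)).mono (hsub hx)).intervalIntegrable
  simp only [rightInverse]
  rw [← mul_add, ← intervalIntegral.integral_add i1 i2]
  congr 1
  refine intervalIntegral.integral_congr fun t ht => ?_
  have ht' := hsub hx ht
  have j1 : IntervalIntegrable (fun s => f s * g s) volume 0 t :=
    ((hfc.mul hg).mono (hsub ht')).intervalIntegrable
  have j2 : IntervalIntegrable (fun s => f s * k s) volume 0 t :=
    ((hfc.mul hk).mono (hsub ht')).intervalIntegrable
  simp_rw [← mul_add, ← intervalIntegral.integral_add j1 j2, mul_add]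

theorem rightInverse_const_mul (c : ℂ) (g : ℝ → ℂ) (x : ℝ) :
    rightInverse f (fun s => c * g s) x = c * rightInverse f g x := by
  simp only [rightInverse, mul_left_comm _ c, intervalIntegral.integral_const_mul]

theorem rightInverse_congr {g k : ℝ → ℂ} (h : EqOn g k (Icc 0 ℓ)) {x : ℝ} (hx : x ∈ Icc 0 ℓ) :
    rightInverse f g x = rightInverse f k x := by
  have hsub : ∀ {t}, t ∈ Icc 0 ℓ → uIcc 0 t ⊆ Icc 0 ℓ := fun {t} ht => by
    rw [uIcc_of_le ht.1]; exact Icc_subset_Icc_right ht.2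
  simp only [rightInverse]
  congr 1
  refine intervalIntegral.integral_congr fun t ht => ?_
  refine congrArg (1 / f t ^ 2 * ·) ?_
  refine intervalIntegral.integral_congr fun s hs => ?_
  simp only [h (hsub (hsub hx ht) hs)]

/-- A crude operator bound without factorial decay is enough: the expansion in formal powers is
needed only for small parameters. -/
theorem exists_norm_rightInverse_le (hℓ : 0 ≤ ℓ) (hfc : ContinuousOn f (Icc 0 ℓ))
    (h0 : ∀ x ∈ Icc 0 ℓ, f x ≠ 0) :
    ∃ A : ℝ, 0 ≤ A ∧ ∀ (g : ℝ → ℂ) (B : ℝ), (∀ x ∈ Icc 0 ℓ, ‖g x‖ ≤ B) →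
      ∀ x ∈ Icc 0 ℓ, ‖rightInverse f g x‖ ≤ A * B := by
  obtain ⟨F, hF⟩ := isCompact_Icc.exists_bound_of_continuousOn hfc
  obtain ⟨G, hG⟩ := isCompact_Icc.exists_bound_of_continuousOn (continuousOn_one_div_sq hfc h0)
  have hF0 : 0 ≤ F := (norm_nonneg _).trans (hF 0 (left_mem_Icc.2 hℓ))
  have hG0 : 0 ≤ G := (norm_nonneg _).trans (hG 0 (left_mem_Icc.2 hℓ))
  refine ⟨F * (G * (F * ℓ) * ℓ), by positivity, fun g B hB x hx => ?_⟩
  have hB0 : 0 ≤ B := (norm_nonneg _).trans (hB 0 (left_mem_Icc.2 hℓ))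
  have hsub : ∀ {t s}, t ∈ Icc 0 ℓ → s ∈ uIoc 0 t → s ∈ Icc 0 ℓ := fun {t s} ht hs => by
    rw [uIoc_of_le ht.1] at hs; exact ⟨hs.1.le, hs.2.trans ht.2⟩
  have h1 : ∀ t ∈ Icc 0 ℓ, ‖∫ s in (0 : ℝ)..t, f s * g s‖ ≤ F * B * ℓ := fun t ht => by
    refine (intervalIntegral.norm_integral_le_of_norm_le_const (C := F * B) fun s hs => ?_).trans ?_
    · rw [norm_mul]
      exact mul_le_mul (hF s (hsub ht hs)) (hB s (hsub ht hs)) (norm_nonneg _) hF0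
    · rw [sub_zero, abs_of_nonneg ht.1]
      exact mul_le_mul_of_nonneg_left ht.2 (by positivity)
  have h2 : ‖∫ t in (0 : ℝ)..x, 1 / f t ^ 2 * ∫ s in (0 : ℝ)..t, f s * g s‖ ≤
      G * (F * B * ℓ) * ℓ := by
    refine (intervalIntegral.norm_integral_le_of_norm_le_const (C := G * (F * B * ℓ))
      fun s hs => ?_).trans ?_
    · rw [norm_mul]
      exact mul_le_mul (hG s (hsub hx hs)) (h1 s (hsub hx hs)) (norm_nonneg _) hG0
    · rw [sub_zero, abs_of_nonneg hx.1]
      exact mul_le_mul_of_nonneg_left hx.2 (by positivity)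
  calc ‖rightInverse f g x‖ ≤ F * (G * (F * B * ℓ) * ℓ) := by
        rw [rightInverse, norm_mul]
        exact mul_le_mul (hF x hx) h2 (norm_nonneg _) hF0
    _ = _ := by ring

/-- The formal powers divided by factorials. -/
def normalizedPower (f : ℝ → ℂ) (k : ℕ) (x : ℝ) : ℂ := ((k.factorial : ℂ))⁻¹ * formalPower f k x

theorem normalizedPower_add_two (k : ℕ) (x : ℝ) :
    normalizedPower f (k + 2) x = rightInverse f (normalizedPower f k) x := by
  have e : normalizedPower f k = fun x => ((k.factorial : ℂ))⁻¹ * formalPower f k x := rfl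
  rw [e, rightInverse_const_mul, normalizedPower, formalPower, Nat.factorial_succ,
    Nat.factorial_succ]
  have h1 : (k : ℂ) + 1 ≠ 0 := by exact_mod_cast Nat.succ_ne_zero k
  have h2 : (k : ℂ) + 2 ≠ 0 := by exact_mod_cast Nat.succ_ne_zero (k + 1)
  have h3 : (k.factorial : ℂ) ≠ 0 := by exact_mod_cast k.factorial_ne_zero
  push_cast
  have h4 : (k : ℂ) + 1 + 1 ≠ 0 := by rwa [add_assoc, one_add_one_eq_two]
  field_simp
  ring

theorem continuousOn_normalizedPower (hℓ : 0 ≤ ℓ) (hfc : ContinuousOn f (Icc 0 ℓ))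
    (h0 : ∀ x ∈ Icc 0 ℓ, f x ≠ 0) (k : ℕ) : ContinuousOn (normalizedPower f k) (Icc 0 ℓ) :=
  continuousOn_const.mul (continuousOn_formalPower hℓ hfc h0 k)

/-- One application of `R_f` costs a factor `A` and raises the index by two. The inequality `A ≤ (A
+ 1)²` gives a geometric bound in `k` without square roots. -/
theorem exists_norm_normalizedPower_le (hℓ : 0 ≤ ℓ) (hfc : ContinuousOn f (Icc 0 ℓ))
    (h0 : ∀ x ∈ Icc 0 ℓ, f x ≠ 0) {A : ℝ} (hA : 0 ≤ A)
    (h : ∀ (g : ℝ → ℂ) (B : ℝ), (∀ x ∈ Icc 0 ℓ, ‖g x‖ ≤ B) →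
      ∀ x ∈ Icc 0 ℓ, ‖rightInverse f g x‖ ≤ A * B) :
    ∃ B : ℝ, ∀ k, ∀ x ∈ Icc 0 ℓ, ‖normalizedPower f k x‖ ≤ B * (A + 1) ^ k := by
  obtain ⟨B₀, hB₀⟩ := isCompact_Icc.exists_bound_of_continuousOn
    (continuousOn_normalizedPower hℓ hfc h0 0)
  obtain ⟨B₁, hB₁⟩ := isCompact_Icc.exists_bound_of_continuousOn
    (continuousOn_normalizedPower hℓ hfc h0 1)
  have hn : 0 ≤ max B₀ B₁ :=
    le_max_of_le_left ((norm_nonneg _).trans (hB₀ 0 (left_mem_Icc.2 hℓ)))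
  refine ⟨max B₀ B₁, fun k => ?_⟩
  induction k using Nat.twoStepInduction with
  | zero => intro x hx; simpa using Or.inl (hB₀ x hx)
  | one =>
    intro x hx
    refine (hB₁ x hx).trans ((le_max_right B₀ B₁).trans (le_mul_of_one_le_right hn ?_))
    rw [pow_one]; linarith
  | more k ih _ =>
    intro x hx
    rw [normalizedPower_add_two]
    refine (h _ _ ih x hx).trans ?_
    have : A ≤ (A + 1) ^ 2 := by nlinarith
    calc A * (max B₀ B₁ * (A + 1) ^ k) ≤ (A + 1) ^ 2 * (max B₀ B₁ * (A + 1) ^ k) := by gcongr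
      _ = _ := by ring

theorem norm_iterate_rightInverse_le {A : ℝ}
    (h : ∀ (g : ℝ → ℂ) (B : ℝ), (∀ x ∈ Icc 0 ℓ, ‖g x‖ ≤ B) →
      ∀ x ∈ Icc 0 ℓ, ‖rightInverse f g x‖ ≤ A * B) {g : ℝ → ℂ} {B : ℝ}
    (hB : ∀ x ∈ Icc 0 ℓ, ‖g x‖ ≤ B) (n : ℕ) :
    ∀ x ∈ Icc 0 ℓ, ‖(rightInverse f)^[n] g x‖ ≤ A ^ n * B := by
  induction n with
  | zero => simpa using hB
  | succ n ih =>
    intro x hx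
    rw [Function.iterate_succ_apply', pow_succ', mul_assoc]
    exact h _ _ ih x hx

/-- This is `R_fⁿ` applied to the Volterra equation, as `R_f` raises the index of the normalized
powers by two. Continuity is carried through the induction because additivity of `R_f` requires it.
-/
theorem eq_sum_normalizedPower_add (hℓ : 0 ≤ ℓ) (hfc : ContinuousOn f (Icc 0 ℓ))
    (h0 : ∀ x ∈ Icc 0 ℓ, f x ≠ 0) {y : ℝ → ℂ} (hy : ContinuousOn y (Icc 0 ℓ)) {z : ℂ}
    (h : ∀ x ∈ Icc 0 ℓ, y x = f x + z * formalPower f 1 x + z ^ 2 * rightInverse f y x) (n : ℕ) :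
    ContinuousOn ((rightInverse f)^[n] y) (Icc 0 ℓ) ∧ ∀ x ∈ Icc 0 ℓ,
      (rightInverse f)^[n] y x = normalizedPower f (2 * n) x + z * normalizedPower f (2 * n + 1) x
        + z ^ 2 * (rightInverse f)^[n + 1] y x := by
  induction n with
  | zero =>
    refine ⟨hy, fun x hx => ?_⟩
    simpa [normalizedPower, formalPower] using h x hx
  | succ n ih =>
    obtain ⟨hc, he⟩ := ih
    have hc1 : ContinuousOn ((rightInverse f)^[n + 1] y) (Icc 0 ℓ) := by
      rw [Function.iterate_succ']
      exact continuousOn_rightInverse hℓ hfc h0 hc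
    refine ⟨hc1, fun x hx => ?_⟩
    rw [Function.iterate_succ_apply', rightInverse_congr (ℓ := ℓ) he hx]
    have c0 := continuousOn_normalizedPower hℓ hfc h0 (2 * n)
    have c1 : ContinuousOn (fun x => z * normalizedPower f (2 * n + 1) x) (Icc 0 ℓ) :=
      continuousOn_const.mul (continuousOn_normalizedPower hℓ hfc h0 (2 * n + 1))
    have c01 : ContinuousOn (fun x => normalizedPower f (2 * n) x +
        z * normalizedPower f (2 * n + 1) x) (Icc 0 ℓ) := c0.add c1
    have c2 : ContinuousOn (fun x => z ^ 2 * (rightInverse f)^[n + 1] y x) (Icc 0 ℓ) :=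
      continuousOn_const.mul hc1
    rw [rightInverse_add hℓ hfc h0 c01 c2 hx, rightInverse_add hℓ hfc h0 c0 c1 hx,
      rightInverse_const_mul, rightInverse_const_mul,
      ← Function.iterate_succ_apply' (rightInverse f) (n + 1)]
    rw [mul_add, mul_one, normalizedPower_add_two, show 2 * n + 2 + 1 = 2 * n + 1 + 2 by ring,
      normalizedPower_add_two]

/-- Solutions of the Volterra equation expand in formal powers, for small values of the
parameter. -/
theorem exists_hasSum_normalizedPower (hℓ : 0 ≤ ℓ) (hfc : ContinuousOn f (Icc 0 ℓ))
    (h0 : ∀ x ∈ Icc 0 ℓ, f x ≠ 0) :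
    ∃ r > 0, ∀ z : ℂ, ‖z‖ < r → ∀ y : ℝ → ℂ, ContinuousOn y (Icc 0 ℓ) →
      (∀ x ∈ Icc 0 ℓ, y x = f x + z * formalPower f 1 x + z ^ 2 * rightInverse f y x) →
      ∀ x ∈ Icc 0 ℓ, HasSum (fun k => z ^ k * normalizedPower f k x) (y x) := by
  obtain ⟨A, hA, hR⟩ := exists_norm_rightInverse_le hℓ hfc h0
  obtain ⟨B, hB⟩ := exists_norm_normalizedPower_le hℓ hfc h0 hA hR
  refine ⟨(A + 1)⁻¹, by positivity, fun z hz y hy h x hx => ?_⟩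
  have hz1 : ‖z‖ * (A + 1) < 1 := by
    rwa [← lt_div_iff₀ (by positivity), one_div]
  have hsum : Summable fun k => z ^ k * normalizedPower f k x := by
    refine Summable.of_norm_bounded (g := fun k => B * (‖z‖ * (A + 1)) ^ k)
      ((summable_geometric_of_lt_one (by positivity) hz1).mul_left B) fun k => ?_
    rw [norm_mul, norm_pow, mul_pow]
    calc ‖z‖ ^ k * ‖normalizedPower f k x‖ ≤ ‖z‖ ^ k * (B * (A + 1) ^ k) := by
          gcongr; exact hB k x hx
      _ = _ := by ring
  -- Iterating the Volterra equation produces two terms at a time, so only partial sums of even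
  -- length are compared with `y x`. Summability of the full series makes this subsequence
  -- sufficient.
  have hpart : ∀ n, y x = ∑ k ∈ Finset.range (2 * n), z ^ k * normalizedPower f k x +
      z ^ (2 * n) * (rightInverse f)^[n] y x := by
    intro n
    induction n with
    | zero => simp
    | succ n ih =>
      rw [ih, (eq_sum_normalizedPower_add hℓ hfc h0 hy h n).2 x hx, mul_add 2 n 1, mul_one,
        Finset.sum_range_succ, Finset.sum_range_succ]
      ring
  obtain ⟨C, hC⟩ := isCompact_Icc.exists_bound_of_continuousOn hy
  have hrem : Filter.Tendsto (fun n : ℕ => z ^ (2 * n) * (rightInverse f)^[n] y x) Filter.atTop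
      (nhds 0) := by
    have hC0 : 0 ≤ C := (norm_nonneg _).trans (hC x hx)
    refine squeeze_zero_norm (a := fun n => C * ((‖z‖ * (A + 1)) ^ 2) ^ n) (fun n => ?_) ?_
    · rw [norm_mul, norm_pow]
      have : A ≤ (A + 1) ^ 2 := by nlinarith
      calc ‖z‖ ^ (2 * n) * ‖(rightInverse f)^[n] y x‖
          ≤ ‖z‖ ^ (2 * n) * (A ^ n * C) := by
            gcongr; exact norm_iterate_rightInverse_le hR hC n x hx
        _ ≤ ‖z‖ ^ (2 * n) * (((A + 1) ^ 2) ^ n * C) := by gcongr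
        _ = _ := by rw [mul_pow, mul_pow, pow_mul]; ring
    · have : (‖z‖ * (A + 1)) ^ 2 < 1 := pow_lt_one₀ (by positivity) hz1 (by norm_num)
      simpa using (tendsto_pow_atTop_nhds_zero_of_lt_one (by positivity) this).const_mul C
  have h2n : Filter.Tendsto (fun n : ℕ => 2 * n) Filter.atTop Filter.atTop :=
    Filter.tendsto_id.const_mul_atTop' (by norm_num)
  have hlim := hsum.hasSum.tendsto_sum_nat.comp h2n
  have hlim2 : Filter.Tendsto (fun n => ∑ k ∈ Finset.range (2 * n), z ^ k * normalizedPower f k x)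
      Filter.atTop (nhds (y x)) := by
    have := (tendsto_const_nhds (x := y x)).sub hrem
    rw [sub_zero] at this
    refine this.congr fun n => ?_
    rw [sub_eq_iff_eq_add]
    exact hpart n
  rw [tendsto_nhds_unique hlim2 hlim]
  exact hsum.hasSum

end FormalPowers

/-- Expansion of the image of an exponential under an integral operator. -/
theorem hasSum_transmutation_exp {K : ℝ → ℝ → ℂ} {x : ℝ} (hx : 0 ≤ x)
    (hK : IntervalIntegrable (K x) volume (-x) x) (z : ℂ) :
    HasSum (fun k : ℕ => z ^ k * (((k.factorial : ℂ))⁻¹ *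
      transmutation K (fun t => (t : ℂ) ^ k) x))
      (transmutation K (fun t => Complex.exp (z * t)) x) := by
  have hexp : ∀ t : ℝ, HasSum (fun k : ℕ => z ^ k * (((k.factorial : ℂ))⁻¹ * (t : ℂ) ^ k))
      (Complex.exp (z * t)) := fun t => by
    have := NormedSpace.expSeries_div_hasSum_exp (𝔸 := ℂ) (z * t)
    rw [← Complex.exp_eq_exp_ℂ] at this
    refine this.congr_fun ?_
    intro k
    rw [mul_pow, div_eq_mul_inv]; ring
  have hle : -x ≤ x := by linarith
  have hint : HasSum (fun k : ℕ => ∫ t in (-x)..x, K x t *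
      (z ^ k * (((k.factorial : ℂ))⁻¹ * (t : ℂ) ^ k)))
      (∫ t in (-x)..x, K x t * Complex.exp (z * t)) := by
    -- On `|t| ≤ x` the series is dominated by `|K x t|` times the exponential series of `‖z‖ x`, so
    -- integrability of `K x` permits termwise integration.
    have hs : Summable fun k : ℕ => (‖z‖ * x) ^ k / (k.factorial : ℝ) :=
      Real.summable_pow_div_factorial _
    refine intervalIntegral.hasSum_integral_of_dominated_convergence
      (fun k t => ‖K x t‖ * ((‖z‖ * x) ^ k / (k.factorial : ℝ))) (fun k => ?_) (fun k => ?_) ?_ ?_ ?_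
    · rw [uIoc_of_le hle]
      refine hK.1.aestronglyMeasurable.mul (Continuous.aestronglyMeasurable ?_)
      fun_prop
    · refine Filter.Eventually.of_forall fun t ht => ?_
      rw [uIoc_of_le hle] at ht
      have : |t| ≤ x := abs_le.2 ⟨ht.1.le, ht.2⟩
      rw [norm_mul, norm_mul, norm_mul, norm_pow, norm_pow, norm_inv, Complex.norm_natCast,
        Complex.norm_real, Real.norm_eq_abs, mul_pow]
      calc ‖K x t‖ * (‖z‖ ^ k * ((k.factorial : ℝ)⁻¹ * |t| ^ k))
          ≤ ‖K x t‖ * (‖z‖ ^ k * ((k.factorial : ℝ)⁻¹ * x ^ k)) := by gcongr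
        _ = _ := by rw [div_eq_mul_inv]; ring
    · exact Filter.Eventually.of_forall fun t _ => hs.mul_left _
    · simp_rw [tsum_mul_left]
      exact hK.norm.mul_const _
    · exact Filter.Eventually.of_forall fun t _ => (hexp t).mul_left _
  refine ((hexp x).add hint).congr_fun ?_
  intro k
  simp only [transmutation]
  simp_rw [mul_left_comm (K x _), intervalIntegral.integral_const_mul]
  ring

/-- Every transmutation kernel maps the powers to the formal powers. -/
theorem IsTransmutationKernel.transmutation_pow {ℓ : ℝ} (hℓ : 0 < ℓ) {q : (ℝ → ℂ) → ℂ} {f : ℝ → ℂ}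
    (hf : IsNonvanishingSolution ℓ q f) {K : ℝ → ℝ → ℂ} (hK : IsTransmutationKernel ℓ q f K)
    (k : ℕ) {x : ℝ} (hx : x ∈ Ioo 0 ℓ) :
    transmutation K (fun t => (t : ℂ) ^ k) x = formalPower f k x := by
  have hfc := hf.solution.memW12.continuousOn hℓ.le
  have hxI := Ioo_subset_Icc_self hx
  obtain ⟨r, hr, H⟩ := exists_hasSum_normalizedPower hℓ.le hfc hf.ne_zero
  set F : ℂ → ℂ := fun z => transmutation K (fun t => Complex.exp (z * t)) x with hF
  have h1 : HasFPowerSeriesAt F (FormalMultilinearSeries.ofScalars ℂ fun k : ℕ =>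
      ((k.factorial : ℂ))⁻¹ * transmutation K (fun t => (t : ℂ) ^ k) x) 0 := by
    rw [hasFPowerSeriesAt_iff]
    refine Filter.Eventually.of_forall fun z => ?_
    simpa [FormalMultilinearSeries.coeff_ofScalars, smul_eq_mul] using
      hasSum_transmutation_exp hx.1.le (hK.integrable x hx) z
  have h2 : HasFPowerSeriesAt F (FormalMultilinearSeries.ofScalars ℂ fun k : ℕ =>
      normalizedPower f k x) 0 := by
    rw [hasFPowerSeriesAt_iff]
    filter_upwards [Metric.ball_mem_nhds (0 : ℂ) hr] with z hz
    rw [mem_ball_zero_iff] at hz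
    -- With `ρ = -i z` one has `iρ = z`. Any solution supplied here will do, since each one
    -- satisfies the Volterra equation; uniqueness is not invoked.
    obtain ⟨e, he, her⟩ := hK.representation (-Complex.I * z)
    have hI : Complex.I * (-Complex.I * z) = z := by
      rw [← mul_assoc, mul_neg, Complex.I_mul_I, neg_neg, one_mul]
    have := H z hz e (he.solution.memW12.continuousOn hℓ.le) (fun x hx => by
      have := he.eq_add_rightInverse hℓ hf hx
      rwa [hI] at this) x hxI
    rw [her x hx, hI] at this
    simpa [FormalMultilinearSeries.coeff_ofScalars, smul_eq_mul] using this
  have h3 := congrArg (fun p => FormalMultilinearSeries.coeff p k)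
    (h1.eq_formalMultilinearSeries h2)
  simp only [FormalMultilinearSeries.coeff_ofScalars, normalizedPower] at h3
  exact mul_left_cancel₀ (inv_ne_zero (by exact_mod_cast k.factorial_ne_zero)) h3

/-! ### Volterra operators along characteristics -/

/-- The operator `g ↦ ∫_0^x h(s) g(s, t - σ (x - s)) ds`. -/
def volterraShift (h : ℝ → ℂ) (σ : ℝ) (g : ℝ → ℝ → ℂ) (x t : ℝ) : ℂ :=
  ∫ s in Ioc 0 x, h s * g s (t - σ * (x - s))

/-- The function `g(x,·)` vanishes outside `[-x,x]`. -/
def SupportedInCone (g : ℝ → ℝ → ℂ) : Prop := ∀ x t : ℝ, x < |t| → g x t = 0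

section Volterra

variable {h : ℝ → ℂ} {σ : ℝ} {g : ℝ → ℝ → ℂ}

/-- Finite propagation speed: a point outside the cone stays outside when followed back along a
characteristic. -/
theorem lt_abs_sub_mul (hσ : |σ| = 1) {x t s : ℝ} (ht : x < |t|) (hs : s ≤ x) :
    s < |t - σ * (x - s)| := by
  have h1 := abs_sub_abs_le_abs_sub t (σ * (x - s))
  rw [abs_mul, hσ, one_mul, abs_of_nonneg (sub_nonneg.2 hs)] at h1
  linarith

theorem SupportedInCone.volterraShift (hσ : |σ| = 1) (hg : SupportedInCone g) :
    SupportedInCone (volterraShift h σ g) := by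
  intro x t ht
  refine setIntegral_eq_zero_of_forall_eq_zero fun s hs => ?_
  rw [hg _ _ (lt_abs_sub_mul hσ ht hs.2), mul_zero]

theorem stronglyMeasurable_volterraShift (hh : StronglyMeasurable h)
    (hg : StronglyMeasurable (Function.uncurry g)) :
    StronglyMeasurable (Function.uncurry (volterraShift h σ g)) := by
  -- The variable upper limit is absorbed into an indicator, leaving an integral of a jointly
  -- measurable function over a fixed domain.
  have e : Function.uncurry (volterraShift h σ g) = fun p : ℝ × ℝ => ∫ s,
      ({w : (ℝ × ℝ) × ℝ | 0 < w.2 ∧ w.2 ≤ w.1.1}.indicator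
        (fun w => h w.2 * Function.uncurry g (w.2, w.1.2 - σ * (w.1.1 - w.2)))) (p, s) := by
    funext ⟨x, t⟩
    simp only [Function.uncurry, volterraShift]
    rw [← integral_indicator measurableSet_Ioc]
    rfl
  rw [e]
  refine StronglyMeasurable.integral_prod_right' (StronglyMeasurable.indicator ?_ ?_)
  · refine (hh.comp_measurable measurable_snd).mul (hg.comp_measurable ?_)
    fun_prop
  · exact (measurableSet_lt measurable_const measurable_snd).inter
      (measurableSet_le measurable_snd measurable_fst.fst)

theorem stronglyMeasurable_shift (hg : StronglyMeasurable (Function.uncurry g)) (x t : ℝ) :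
    StronglyMeasurable fun s => g s (t - σ * (x - s)) := by
  have : Measurable fun s : ℝ => (s, t - σ * (x - s)) := by fun_prop
  exact hg.comp_measurable this

theorem integrableOn_volterraShift_of_bound (hh : Integrable h)
    (hg : StronglyMeasurable (Function.uncurry g)) {x C : ℝ}
    (hC : ∀ s ∈ Ioc 0 x, ∀ t, ‖g s t‖ ≤ C) (t : ℝ) :
    IntegrableOn (fun s => h s * g s (t - σ * (x - s))) (Ioc 0 x) := by
  have := hh.integrableOn (s := Ioc 0 x)
  refine Integrable.mul_bdd (c := C) this
    (stronglyMeasurable_shift hg x t).aestronglyMeasurable ?_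
  filter_upwards [ae_restrict_mem measurableSet_Ioc] with s hs
  exact hC s hs _

/-- For an `L²` function `h`, the exponential weights that make `volterraShift` a contraction. -/
theorem exists_setIntegral_norm_mul_exp_le (hh : MemLp h 2) :
    ∃ l : ℝ, 0 < l ∧ ∀ x : ℝ, 0 ≤ x →
      ∫ s in Ioc 0 x, ‖h s‖ * Real.exp (l * s) ≤ 1 / 2 * Real.exp (l * x) := by
  have hi : Integrable fun s => ‖h s‖ ^ 2 := hh.norm.integrable_sq
  set H := ∫ s, ‖h s‖ ^ 2 with hH
  have hH0 : 0 ≤ H := integral_nonneg fun s => by positivity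
  set l := 2 * (H + 1) with hl
  have hl0 : 0 < l := by positivity
  refine ⟨l, hl0, fun x hx => ?_⟩
  set E := Real.exp (l * x) with hE
  have hE0 : 0 < E := Real.exp_pos _
  have b1 : ∀ s, ‖h s‖ * Real.exp (l * s) ≤
      E / (2 * l) * ‖h s‖ ^ 2 + l / (2 * E) * Real.exp (2 * l * s) := by
    intro s
    have e1 : Real.exp (2 * l * s) = Real.exp (l * s) ^ 2 := by
      rw [← Real.exp_nat_mul]; congr 1; push_cast; ring
    rw [e1]
    have e2 : E / (2 * l) * ‖h s‖ ^ 2 + l / (2 * E) * Real.exp (l * s) ^ 2 -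
        ‖h s‖ * Real.exp (l * s) =
        l / (2 * E) * (E / l * ‖h s‖ - Real.exp (l * s)) ^ 2 := by
      field_simp; ring
    have : 0 ≤ l / (2 * E) * (E / l * ‖h s‖ - Real.exp (l * s)) ^ 2 := by positivity
    linarith
  have j2 : IntegrableOn (fun s => Real.exp (2 * l * s)) (Ioc 0 x) :=
    (Continuous.integrableOn_Icc (by fun_prop)).mono_set Ioc_subset_Icc_self
  have hexp : ∫ s in Ioc 0 x, Real.exp (2 * l * s) ≤ E ^ 2 / (2 * l) := by
    rw [← intervalIntegral.integral_of_le hx, intervalIntegral.integral_comp_mul_left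
      (fun s => Real.exp s) (by positivity), integral_exp, smul_eq_mul, mul_zero, Real.exp_zero]
    have e1 : Real.exp (2 * l * x) = E ^ 2 := by
      rw [hE, ← Real.exp_nat_mul]; congr 1; push_cast; ring
    rw [e1, div_eq_inv_mul]
    gcongr
    linarith
  have hsq : ∫ s in Ioc 0 x, ‖h s‖ ^ 2 ≤ H :=
    setIntegral_le_integral hi (Filter.Eventually.of_forall fun s => by positivity)
  calc ∫ s in Ioc 0 x, ‖h s‖ * Real.exp (l * s)
      ≤ ∫ s in Ioc 0 x, (E / (2 * l) * ‖h s‖ ^ 2 + l / (2 * E) * Real.exp (2 * l * s)) :=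
        integral_mono_of_nonneg (Filter.Eventually.of_forall fun s => by positivity)
          ((hi.integrableOn.const_mul _).add (j2.const_mul _)) (Filter.Eventually.of_forall b1)
    _ = (E / (2 * l) * ∫ s in Ioc 0 x, ‖h s‖ ^ 2) +
          l / (2 * E) * ∫ s in Ioc 0 x, Real.exp (2 * l * s) := by
        rw [integral_add (hi.integrableOn.const_mul _) (j2.const_mul _), integral_const_mul,
          integral_const_mul]
    _ ≤ E / (2 * l) * (l / 2) + l / (2 * E) * (E ^ 2 / (2 * l)) := by
        refine add_le_add (mul_le_mul_of_nonneg_left ?_ (by positivity))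
          (mul_le_mul_of_nonneg_left hexp (by positivity))
        linarith
    _ = 1 / 2 * E := by field_simp; ring

theorem integral_norm_volterraShift_le (hh : Integrable h) {l : ℝ}
    (hl : ∀ x : ℝ, 0 ≤ x → ∫ s in Ioc 0 x, ‖h s‖ * Real.exp (l * s) ≤ 1 / 2 * Real.exp (l * x))
    {B : ℝ} (hB : ∀ s t, 0 ≤ s → ‖g s t‖ ≤ B * Real.exp (l * s)) {x : ℝ} (hx : 0 ≤ x) (t : ℝ) :
    ∫ s in Ioc 0 x, ‖h s * g s (t - σ * (x - s))‖ ≤ B / 2 * Real.exp (l * x) := by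
  have hB0 : 0 ≤ B := by
    have := (norm_nonneg _).trans (hB 0 0 le_rfl)
    simpa using this
  have hi : IntegrableOn (fun s => ‖h s‖ * Real.exp (l * s)) (Ioc 0 x) := by
    refine (hh.norm.integrableOn (s := Icc 0 x)).mul_continuousOn (by fun_prop) isCompact_Icc
      |>.mono_set Ioc_subset_Icc_self
  calc ∫ s in Ioc 0 x, ‖h s * g s (t - σ * (x - s))‖
      ≤ ∫ s in Ioc 0 x, B * (‖h s‖ * Real.exp (l * s)) := by
        refine integral_mono_of_nonneg (Filter.Eventually.of_forall fun s => norm_nonneg _)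
          (hi.const_mul B) ?_
        filter_upwards [ae_restrict_mem measurableSet_Ioc] with s hs
        rw [norm_mul, mul_left_comm]
        exact mul_le_mul_of_nonneg_left (hB s _ hs.1.le) (norm_nonneg _)
    _ ≤ B * (1 / 2 * Real.exp (l * x)) := by
        rw [integral_const_mul]
        exact mul_le_mul_of_nonneg_left (hl x hx) hB0
    _ = _ := by ring

theorem volterraShift_tsum (hh : Integrable h) {l : ℝ}
    (hl : ∀ x : ℝ, 0 ≤ x → ∫ s in Ioc 0 x, ‖h s‖ * Real.exp (l * s) ≤ 1 / 2 * Real.exp (l * x))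
    {G : ℕ → ℝ → ℝ → ℂ} (hG : ∀ n, StronglyMeasurable (Function.uncurry (G n))) {b : ℕ → ℝ}
    (hb : Summable b) (hl0 : 0 ≤ l) (hGb : ∀ n s t, 0 ≤ s → ‖G n s t‖ ≤ b n * Real.exp (l * s))
    {x : ℝ} (hx : 0 ≤ x) (t : ℝ) :
    volterraShift h σ (fun s t => ∑' n, G n s t) x t = ∑' n, volterraShift h σ (G n) x t := by
  have hb0 : ∀ n, 0 ≤ b n := fun n => by
    have := (norm_nonneg _).trans (hGb n 0 0 le_rfl)
    simpa using this
  have key := hasSum_integral_of_summable_integral_norm (μ := volume.restrict (Ioc 0 x))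
    (F := fun n s => h s * G n s (t - σ * (x - s))) (fun n => by
      refine integrableOn_volterraShift_of_bound hh (hG n) (C := b n * Real.exp (l * x))
        (fun s hs t => (hGb n s t hs.1.le).trans ?_) t
      have := hb0 n
      have := hs.2
      gcongr) (by
      refine Summable.of_nonneg_of_le (fun n => integral_nonneg fun s => norm_nonneg _)
        (fun n => integral_norm_volterraShift_le hh hl (hGb n) hx t) ?_
      exact (hb.div_const 2).mul_right _)
  simp_rw [tsum_mul_left] at key
  exact key.tsum_eq.symm

/-- The Fourier transform in `t` of `volterraShift h σ g`. -/
theorem fourier_volterraShift (hh : Integrable h) (hhm : StronglyMeasurable h) (hσ : |σ| = 1)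
    (hg : StronglyMeasurable (Function.uncurry g)) (hgs : SupportedInCone g) {x C : ℝ}
    (hC : ∀ s ∈ Ioc 0 x, Integrable (g s) ∧ ∫ t, ‖g s t‖ ≤ C) (ρ : ℂ) :
    Integrable (fun t : ℝ => volterraShift h σ g x t * Complex.exp (Complex.I * ρ * t)) ∧
    IntegrableOn (fun s : ℝ => h s * (Complex.exp (Complex.I * ρ * (σ * (x - s))) *
      ∫ t, g s t * Complex.exp (Complex.I * ρ * t))) (Ioc 0 x) ∧
    ∫ t, volterraShift h σ g x t * Complex.exp (Complex.I * ρ * t) =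
      ∫ s in Ioc 0 x, h s * (Complex.exp (Complex.I * ρ * (σ * (x - s))) *
        ∫ t, g s t * Complex.exp (Complex.I * ρ * t)) := by
  have hΦm : StronglyMeasurable fun p : ℝ × ℝ => h p.2 * g p.2 (p.1 - σ * (x - p.2)) := by
    refine (hhm.comp_measurable measurable_snd).mul ?_
    have : Measurable fun p : ℝ × ℝ => (p.2, p.1 - σ * (x - p.2)) := by fun_prop
    exact hg.comp_measurable this
  have hΦ : Integrable (fun p : ℝ × ℝ => h p.2 * g p.2 (p.1 - σ * (x - p.2)))
      (volume.prod (volume.restrict (Ioc 0 x))) := by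
    rw [integrable_prod_iff' hΦm.aestronglyMeasurable]
    constructor
    · filter_upwards [ae_restrict_mem measurableSet_Ioc] with s hs
      exact ((hC s hs).1.comp_sub_right _).const_mul _
    · refine Integrable.mono' (g := fun s => ‖h s‖ * C) (hh.norm.integrableOn.mul_const C)
        (hΦm.norm.integral_prod_left' (μ := volume)).aestronglyMeasurable ?_
      filter_upwards [ae_restrict_mem measurableSet_Ioc] with s hs
      rw [Real.norm_of_nonneg (integral_nonneg fun _ => norm_nonneg _)]
      simp_rw [norm_mul]
      rw [integral_const_mul, integral_sub_right_eq_self (fun t => ‖g s t‖)]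
      exact mul_le_mul_of_nonneg_left (hC s hs).2 (norm_nonneg _)
  -- For complex `ρ` the exponential is unbounded in `t`, but the integrand vanishes for `|t| > x`,
  -- where `x` is fixed.
  have hΨ : Integrable (fun p : ℝ × ℝ => h p.2 * g p.2 (p.1 - σ * (x - p.2)) *
      Complex.exp (Complex.I * ρ * p.1)) (volume.prod (volume.restrict (Ioc 0 x))) := by
    refine Integrable.mono (hΦ.norm.mul_const (Real.exp (‖ρ‖ * x)))
      (hΦm.mul (Continuous.stronglyMeasurable (by fun_prop))).aestronglyMeasurable ?_
    have hmem : ∀ᵐ p : ℝ × ℝ ∂(volume.prod (volume.restrict (Ioc 0 x))), p.2 ∈ Ioc 0 x :=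
      Measure.quasiMeasurePreserving_snd.ae (ae_restrict_mem measurableSet_Ioc)
    filter_upwards [hmem] with p hp
    rw [norm_mul, norm_mul (‖_‖) _, norm_norm, Real.norm_of_nonneg (Real.exp_pos _).le]
    rcases le_or_gt |p.1| x with h1 | h1
    · gcongr
      refine (Complex.norm_exp_le_exp_norm _).trans (Real.exp_le_exp.2 ?_)
      rw [norm_mul, norm_mul, Complex.norm_I, one_mul, Complex.norm_real, Real.norm_eq_abs]
      gcongr
    · rw [hgs _ _ (lt_abs_sub_mul hσ h1 hp.2)]
      simp
  have e1 : ∀ t : ℝ, ∫ s in Ioc 0 x, h s * g s (t - σ * (x - s)) *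
      Complex.exp (Complex.I * ρ * t) =
      volterraShift h σ g x t * Complex.exp (Complex.I * ρ * t) := fun t => by
    rw [integral_mul_const]; rfl
  have e2 : ∀ s : ℝ, ∫ t : ℝ, h s * g s (t - σ * (x - s)) * Complex.exp (Complex.I * ρ * t) =
      h s * (Complex.exp (Complex.I * ρ * (σ * (x - s))) *
        ∫ t, g s t * Complex.exp (Complex.I * ρ * t)) := fun s => by
    rw [← integral_add_right_eq_self _ (σ * (x - s)), ← integral_const_mul, ← integral_const_mul]
    congr 1
    funext t
    rw [add_sub_cancel_right]
    push_cast
    rw [mul_add, Complex.exp_add]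
    ring
  refine ⟨?_, ?_, ?_⟩
  · have := hΨ.integral_prod_left
    simpa only [e1] using this
  · have := hΨ.integral_prod_right
    simp only [e2] at this
    exact this
  · simp_rw [← e1, ← e2]
    exact integral_integral_swap hΨ

end Volterra

/-! ### The kernel -/

/-- The singular part `½ h((x+t)/2)`, `|t| ≤ x`, of the kernel. -/
def singularKernel (h : ℝ → ℂ) (x t : ℝ) : ℂ :=
  if |t| ≤ x then 1 / 2 * h ((x + t) / 2) else 0

/-- The Neumann iterates of the regular part of the kernel. -/
def kernelIterate (h : ℝ → ℂ) : ℕ → ℝ → ℝ → ℂ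
  | 0 => volterraShift h 1 (singularKernel h)
  | n + 1 => volterraShift h 1 (volterraShift h (-1) (kernelIterate h n))

/-- The part of the kernel carried by the right-moving wave. -/
def kernelPlus (h : ℝ → ℂ) (x t : ℝ) : ℂ := ∑' n, kernelIterate h n x t

/-- The part of the kernel carried by the left-moving wave. -/
def kernelMinus (h : ℝ → ℂ) (x t : ℝ) : ℂ :=
  singularKernel h x t + volterraShift h (-1) (kernelPlus h) x t

section Kernel

variable {h : ℝ → ℂ}

theorem supportedInCone_singularKernel : SupportedInCone (singularKernel h) := fun _ _ ht =>
  if_neg (not_le.2 ht)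

theorem stronglyMeasurable_singularKernel (hhm : StronglyMeasurable h) :
    StronglyMeasurable (Function.uncurry (singularKernel h)) := by
  have hm : Measurable fun p : ℝ × ℝ => (p.1 + p.2) / 2 := by fun_prop
  exact StronglyMeasurable.ite (measurableSet_le (by fun_prop) measurable_fst)
    ((hhm.comp_measurable hm).const_mul _) stronglyMeasurable_const

theorem norm_singularKernel_le (x t : ℝ) :
    ‖singularKernel h x t‖ ≤ 1 / 2 * ‖h ((t + x) / 2)‖ := by
  rw [singularKernel, add_comm x t]
  split_ifs
  · simp
  · rw [norm_zero]; positivity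

theorem integrable_comp_add_div_two {E : Type*} [NormedAddCommGroup E] {u : ℝ → E}
    (hu : Integrable u) (x : ℝ) : Integrable fun t => u ((t + x) / 2) :=
  (hu.comp_div (two_ne_zero)).comp_add_right x

theorem integral_comp_add_div_two (u : ℝ → ℝ) (x : ℝ) :
    ∫ t, u ((t + x) / 2) = 2 * ∫ t, u t := by
  rw [integral_add_right_eq_self (fun t => u (t / 2)), Measure.integral_comp_div]
  simp

theorem integrable_singularKernel (hh : Integrable h) (hhm : StronglyMeasurable h) (x : ℝ) :
    Integrable (singularKernel h x) ∧ ∫ t, ‖singularKernel h x t‖ ≤ ∫ t, ‖h t‖ := by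
  have hb := (integrable_comp_add_div_two hh.norm x).const_mul (1 / 2)
  have hm : StronglyMeasurable (singularKernel h x) :=
    (stronglyMeasurable_singularKernel hhm).comp_measurable measurable_prodMk_left
  refine ⟨hb.mono' hm.aestronglyMeasurable
    (Filter.Eventually.of_forall fun t => norm_singularKernel_le x t), ?_⟩
  refine (integral_mono_of_nonneg (Filter.Eventually.of_forall fun s => norm_nonneg _) hb
    (Filter.Eventually.of_forall fun t => norm_singularKernel_le x t)).trans_eq ?_
  rw [integral_const_mul, integral_comp_add_div_two (fun t => ‖h t‖)]
  ring

/-- The substitution `t = 2s - x` identifies the singular kernel with the left-moving wave generated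
by `h` from the free wave `e^{iρs}`. -/
theorem fourier_singularKernel {x : ℝ} (hx : 0 ≤ x) (ρ : ℂ) :
    ∫ t, singularKernel h x t * Complex.exp (Complex.I * ρ * t) =
      ∫ s in Ioc 0 x, h s * (Complex.exp (Complex.I * ρ * ((-1 : ℝ) * (x - s))) *
        Complex.exp (Complex.I * ρ * s)) := by
  have e1 : ∫ t, singularKernel h x t * Complex.exp (Complex.I * ρ * t) =
      ∫ t in (-x)..x, 1 / 2 * (h ((x + t) / 2) * Complex.exp (Complex.I * ρ * t)) := by
    rw [intervalIntegral.integral_of_le (by linarith), ← integral_Icc_eq_integral_Ioc,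
      ← integral_indicator measurableSet_Icc]
    congr 1
    funext t
    rw [singularKernel, indicator_apply]
    simp only [mem_Icc, ← abs_le]
    split_ifs <;> ring
  rw [e1, ← intervalIntegral.integral_of_le hx]
  have e2 := intervalIntegral.integral_comp_mul_sub (a := 0) (b := x)
    (fun t : ℝ => h ((x + t) / 2) * Complex.exp (Complex.I * ρ * t)) (two_ne_zero (α := ℝ)) x
  rw [mul_zero, zero_sub, show 2 * x - x = x by ring] at e2
  rw [intervalIntegral.integral_const_mul]
  have e3 : (1 / 2 : ℂ) * ∫ t in (-x)..x, h ((x + t) / 2) * Complex.exp (Complex.I * ρ * t) =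
      (2 : ℝ)⁻¹ • ∫ t in (-x)..x, h ((x + t) / 2) * Complex.exp (Complex.I * ρ * t) := by
    rw [Complex.real_smul]; push_cast; ring
  rw [e3, ← e2]
  refine intervalIntegral.integral_congr fun s _ => ?_
  change h ((x + (2 * s - x)) / 2) * _ = _
  rw [← Complex.exp_add, show (x + (2 * s - x)) / 2 = s by ring]
  congr 2
  push_cast
  ring

/-- Along the characteristic the argument of `h` in the singular kernel is the translate `s + (t -
x)/2`. By `2ab ≤ a² + b²` the product is therefore dominated by an integrable function of `s` whose
integral does not depend on `x` and `t`. This makes the zeroth iterate bounded although the singular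
kernel need not be. -/
theorem norm_mul_singularKernel_le (x t s : ℝ) :
    ‖h s * singularKernel h s (t - 1 * (x - s))‖ ≤
      1 / 4 * (‖h s‖ ^ 2 + ‖h (s + (t - x) / 2)‖ ^ 2) := by
  rw [norm_mul]
  have h1 := norm_singularKernel_le (h := h) s (t - 1 * (x - s))
  rw [show (t - 1 * (x - s) + s) / 2 = s + (t - x) / 2 by ring] at h1
  have h2 := mul_le_mul_of_nonneg_left h1 (norm_nonneg (h s))
  nlinarith [sq_nonneg (‖h s‖ - ‖h (s + (t - x) / 2)‖)]

theorem integrable_singular_bound (hh : MemLp h 2) (c : ℝ) :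
    Integrable fun s => 1 / 4 * (‖h s‖ ^ 2 + ‖h (s + c)‖ ^ 2) := by
  have hi : Integrable fun s => ‖h s‖ ^ 2 := hh.norm.integrable_sq
  exact (hi.add (hi.comp_add_right c)).const_mul _

theorem integrableOn_mul_singularKernel (hh : MemLp h 2) (hhm : StronglyMeasurable h) (x t : ℝ) :
    IntegrableOn (fun s => h s * singularKernel h s (t - 1 * (x - s))) (Ioc 0 x) :=
  (integrable_singular_bound hh ((t - x) / 2)).integrableOn.mono'
    (hhm.mul (stronglyMeasurable_shift
      (stronglyMeasurable_singularKernel hhm) x t)).aestronglyMeasurable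
    (Filter.Eventually.of_forall fun s => norm_mul_singularKernel_le x t s)

theorem norm_kernelIterate_zero_le (hh : MemLp h 2) (x t : ℝ) :
    ‖kernelIterate h 0 x t‖ ≤ ∫ s, ‖h s‖ ^ 2 := by
  have hi : Integrable fun s => ‖h s‖ ^ 2 := hh.norm.integrable_sq
  have hb := integrable_singular_bound hh ((t - x) / 2)
  have h0 : 0 ≤ ∫ s, ‖h s‖ ^ 2 := integral_nonneg fun s => by positivity
  calc ‖kernelIterate h 0 x t‖
      ≤ ∫ s in Ioc 0 x, 1 / 4 * (‖h s‖ ^ 2 + ‖h (s + (t - x) / 2)‖ ^ 2) :=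
        norm_integral_le_of_norm_le hb.integrableOn
          (Filter.Eventually.of_forall fun s => norm_mul_singularKernel_le x t s)
    _ ≤ ∫ s, 1 / 4 * (‖h s‖ ^ 2 + ‖h (s + (t - x) / 2)‖ ^ 2) :=
        setIntegral_le_integral hb (Filter.Eventually.of_forall fun s => by positivity)
    _ = 1 / 2 * ∫ s, ‖h s‖ ^ 2 := by
        rw [integral_const_mul, integral_add hi (hi.comp_add_right _),
          integral_add_right_eq_self (fun s => ‖h s‖ ^ 2)]
        ring
    _ ≤ _ := by linarith

theorem supportedInCone_kernelIterate : ∀ n, SupportedInCone (kernelIterate h n)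
  | 0 => supportedInCone_singularKernel.volterraShift (by simp)
  | n + 1 => ((supportedInCone_kernelIterate n).volterraShift (by simp)).volterraShift (by simp)

theorem stronglyMeasurable_kernelIterate (hhm : StronglyMeasurable h) :
    ∀ n, StronglyMeasurable (Function.uncurry (kernelIterate h n))
  | 0 => stronglyMeasurable_volterraShift hhm (stronglyMeasurable_singularKernel hhm)
  | n + 1 => stronglyMeasurable_volterraShift hhm
      (stronglyMeasurable_volterraShift hhm (stronglyMeasurable_kernelIterate hhm n))

theorem norm_volterraShift_le (hh : Integrable h) {l : ℝ}
    (hl : ∀ x : ℝ, 0 ≤ x → ∫ s in Ioc 0 x, ‖h s‖ * Real.exp (l * s) ≤ 1 / 2 * Real.exp (l * x))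
    {σ : ℝ} {g : ℝ → ℝ → ℂ} {B : ℝ} (hB : ∀ s t, 0 ≤ s → ‖g s t‖ ≤ B * Real.exp (l * s)) (x t : ℝ)
    (hx : 0 ≤ x) : ‖volterraShift h σ g x t‖ ≤ B / 2 * Real.exp (l * x) :=
  (norm_integral_le_integral_norm _).trans (integral_norm_volterraShift_le hh hl hB hx t)

/-- Each iteration applies two Volterra operators, and each of them halves the weighted bound. -/
theorem norm_kernelIterate_le (hh : Integrable h) (hh2 : MemLp h 2) {l : ℝ} (hl0 : 0 ≤ l)
    (hl : ∀ x : ℝ, 0 ≤ x → ∫ s in Ioc 0 x, ‖h s‖ * Real.exp (l * s) ≤ 1 / 2 * Real.exp (l * x))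
    (n : ℕ) : ∀ x t : ℝ, 0 ≤ x →
      ‖kernelIterate h n x t‖ ≤ (∫ s, ‖h s‖ ^ 2) * (1 / 4) ^ n * Real.exp (l * x) := by
  induction n with
  | zero =>
    intro x t hx
    rw [pow_zero, mul_one]
    refine (norm_kernelIterate_zero_le hh2 x t).trans (le_mul_of_one_le_right
      (integral_nonneg fun s => by positivity) (Real.one_le_exp (by positivity)))
  | succ n ih =>
    intro x t hx
    refine (norm_volterraShift_le hh hl (norm_volterraShift_le hh hl ih) x t hx).trans_eq ?_
    rw [pow_succ]; ring

theorem summable_kernelIterate_bound (h : ℝ → ℂ) :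
    Summable fun n : ℕ => (∫ s, ‖h s‖ ^ 2) * (1 / 4 : ℝ) ^ n :=
  (summable_geometric_of_lt_one (by norm_num) (by norm_num)).mul_left _

theorem summable_kernelIterate (hh : Integrable h) (hh2 : MemLp h 2) (x t : ℝ) :
    Summable fun n => kernelIterate h n x t := by
  obtain ⟨l, hl0, hl⟩ := exists_setIntegral_norm_mul_exp_le hh2
  rcases lt_or_ge x 0 with hx | hx
  · simp_rw [supportedInCone_kernelIterate _ x t (hx.trans_le (abs_nonneg t))]
    exact summable_zero
  · exact Summable.of_norm_bounded ((summable_kernelIterate_bound h).mul_right _)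
      fun n => norm_kernelIterate_le hh hh2 hl0.le hl n x t hx

theorem supportedInCone_kernelPlus : SupportedInCone (kernelPlus h) := fun x t ht => by
  simp [kernelPlus, supportedInCone_kernelIterate _ x t ht]

theorem stronglyMeasurable_kernelPlus (hh : Integrable h) (hh2 : MemLp h 2)
    (hhm : StronglyMeasurable h) : StronglyMeasurable (Function.uncurry (kernelPlus h)) := by
  refine stronglyMeasurable_of_tendsto Filter.atTop
    (f := fun n p => ∑ k ∈ Finset.range n, Function.uncurry (kernelIterate h k) p) (fun n => ?_) ?_
  · exact Finset.stronglyMeasurable_fun_sum _ fun k _ => stronglyMeasurable_kernelIterate hhm k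
  · rw [tendsto_pi_nhds]
    rintro ⟨x, t⟩
    exact (summable_kernelIterate hh hh2 x t).hasSum.tendsto_sum_nat

theorem exists_norm_kernelPlus_le (hh : Integrable h) (hh2 : MemLp h 2) {l : ℝ} (hl0 : 0 ≤ l)
    (hl : ∀ x : ℝ, 0 ≤ x → ∫ s in Ioc 0 x, ‖h s‖ * Real.exp (l * s) ≤ 1 / 2 * Real.exp (l * x)) :
    ∃ B, 0 ≤ B ∧ ∀ x t : ℝ, 0 ≤ x → ‖kernelPlus h x t‖ ≤ B * Real.exp (l * x) := by
  refine ⟨∑' n : ℕ, (∫ s, ‖h s‖ ^ 2) * (1 / 4 : ℝ) ^ n,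
    tsum_nonneg fun n => mul_nonneg (integral_nonneg fun s => by positivity) (by positivity),
    fun x t hx => ?_⟩
  rw [← tsum_mul_right]
  exact tsum_of_norm_bounded ((summable_kernelIterate_bound h).mul_right _).hasSum
    fun n => norm_kernelIterate_le hh hh2 hl0 hl n x t hx

/-- The integral equation that couples the two parts of the kernel. -/
theorem kernelPlus_eq (hh : Integrable h) (hh2 : MemLp h 2) (hhm : StronglyMeasurable h)
    {x : ℝ} (hx : 0 ≤ x) (t : ℝ) :
    kernelPlus h x t = volterraShift h 1 (kernelMinus h) x t := by
  obtain ⟨l, hl0, hl⟩ := exists_setIntegral_norm_mul_exp_le hh2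
  obtain ⟨B, hB0, hB⟩ := exists_norm_kernelPlus_le hh hh2 hl0.le hl
  have hit := norm_kernelIterate_le hh hh2 hl0.le hl
  have hsb := summable_kernelIterate_bound h
  have hmi := stronglyMeasurable_kernelIterate hhm
  have hAP : StronglyMeasurable (Function.uncurry (volterraShift h (-1) (kernelPlus h))) :=
    stronglyMeasurable_volterraShift hhm (stronglyMeasurable_kernelPlus hh hh2 hhm)
  have hAPb := norm_volterraShift_le (σ := -1) hh hl hB
  have e1 : volterraShift h 1 (kernelMinus h) x t = kernelIterate h 0 x t +
      volterraShift h 1 (volterraShift h (-1) (kernelPlus h)) x t := by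
    simp only [kernelIterate]
    rw [volterraShift, volterraShift, volterraShift, ← integral_add
      (integrableOn_mul_singularKernel hh2 hhm x t)
      (integrableOn_volterraShift_of_bound hh hAP (C := B / 2 * Real.exp (l * x))
        (fun s hs t => (hAPb s t hs.1.le).trans (by
          have := hs.2
          gcongr)) t)]
    simp only [kernelMinus, mul_add]
  -- The sum passes through the inner operator here and through the outer one below; the result is
  -- the Neumann series without its first term.
  have e2 : volterraShift h 1 (volterraShift h (-1) (kernelPlus h)) x t =
      volterraShift h 1 (fun s t => ∑' n, volterraShift h (-1) (kernelIterate h n) s t) x t := by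
    refine setIntegral_congr_fun measurableSet_Ioc fun s hs => ?_
    refine congrArg (h s * ·) ?_
    exact volterraShift_tsum hh hl hmi hsb hl0.le (fun n s t hs => hit n s t hs) hs.1.le _
  rw [e1, e2, volterraShift_tsum hh hl
    (fun n => stronglyMeasurable_volterraShift hhm (hmi n)) (hsb.div_const 2) hl0.le
    (fun n => norm_volterraShift_le hh hl (hit n)) hx, kernelPlus,
    (summable_kernelIterate hh hh2 x t).tsum_eq_zero_add]
  rfl

theorem supportedInCone_kernelMinus : SupportedInCone (kernelMinus h) := fun x t ht => by
  rw [kernelMinus, supportedInCone_singularKernel x t ht,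
    supportedInCone_kernelPlus.volterraShift (by simp) x t ht, add_zero]

theorem stronglyMeasurable_kernelMinus (hh : Integrable h) (hh2 : MemLp h 2)
    (hhm : StronglyMeasurable h) : StronglyMeasurable (Function.uncurry (kernelMinus h)) :=
  (stronglyMeasurable_singularKernel hhm).add
    (stronglyMeasurable_volterraShift hhm (stronglyMeasurable_kernelPlus hh hh2 hhm))

/-- A bounded function supported in a compact interval is integrable. -/
theorem SupportedInCone.integrable_of_bound {g : ℝ → ℝ → ℂ} (hgs : SupportedInCone g)
    (hg : StronglyMeasurable (Function.uncurry g)) {x C : ℝ} (hx : 0 ≤ x)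
    (hC : ∀ t, ‖g x t‖ ≤ C) : Integrable (g x) ∧ ∫ t, ‖g x t‖ ≤ 2 * x * C := by
  have hm : StronglyMeasurable (g x) := hg.comp_measurable measurable_prodMk_left
  have hs : (Icc (-x) x).indicator (g x) = g x := by
    refine indicator_eq_self.2 fun t ht => ?_
    by_contra hn
    exact ht (hgs x t (not_le.1 fun hle => hn (abs_le.1 hle)))
  have hi : IntegrableOn (g x) (Icc (-x) x) :=
    Measure.integrableOn_of_bounded (M := C) (by simp) hm.aestronglyMeasurable
      (Filter.Eventually.of_forall hC)
  refine ⟨by rw [← hs]; exact hi.integrable_indicator measurableSet_Icc, ?_⟩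
  have e : ∫ t, ‖g x t‖ = ∫ t in Icc (-x) x, ‖g x t‖ := by
    rw [← integral_indicator measurableSet_Icc]
    congr 1
    funext t
    conv_lhs => rw [← hs]
    rw [norm_indicator_eq_indicator_norm]
  rw [e]
  have : ∫ t in Icc (-x) x, ‖g x t‖ ≤ ∫ t in Icc (-x) x, C :=
    integral_mono hi.norm (by simp) hC
  refine this.trans_eq ?_
  rw [setIntegral_const, smul_eq_mul, Measure.real, Real.volume_Icc,
    ENNReal.toReal_ofReal (by linarith)]
  ring

/-- Square integrability and integrability of the kernel. -/
theorem memLp_kernel (hh : Integrable h) (hh2 : MemLp h 2) (hhm : StronglyMeasurable h) (ℓ : ℝ) :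
    MemLp (fun p : ℝ × ℝ => kernelPlus h p.1 p.2 + kernelMinus h p.1 p.2) 2
      (volume.restrict (triangle ℓ)) := by
  obtain ⟨l, hl0, hl⟩ := exists_setIntegral_norm_mul_exp_le hh2
  obtain ⟨B, hB0, hB⟩ := exists_norm_kernelPlus_le hh hh2 hl0.le hl
  have hPm := stronglyMeasurable_kernelPlus hh hh2 hhm
  have hAP := stronglyMeasurable_volterraShift (σ := -1) hhm hPm
  have hAPb := norm_volterraShift_le (σ := -1) hh hl hB
  have hTm : MeasurableSet (triangle ℓ) :=
    (measurableSet_le measurable_const measurable_fst).inter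
      ((measurableSet_le measurable_fst measurable_const).inter
        (measurableSet_le (by fun_prop) measurable_fst))
  have hTsub : triangle ℓ ⊆ Icc 0 ℓ ×ˢ Icc (-ℓ) ℓ := fun p hp =>
    ⟨⟨hp.1, hp.2.1⟩, abs_le.1 (hp.2.2.trans hp.2.1)⟩
  have hfin : IsFiniteMeasure ((volume : Measure (ℝ × ℝ)).restrict (triangle ℓ)) :=
    isFiniteMeasure_restrict.2 (ne_top_of_le_ne_top
      (isCompact_Icc.prod isCompact_Icc).measure_lt_top.ne (measure_mono hTsub))
  have bd : ∀ {g : ℝ → ℝ → ℂ} {C : ℝ}, 0 ≤ C → StronglyMeasurable (Function.uncurry g) →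
      (∀ x t : ℝ, 0 ≤ x → ‖g x t‖ ≤ C * Real.exp (l * x)) →
      MemLp (fun p : ℝ × ℝ => g p.1 p.2) 2 (volume.restrict (triangle ℓ)) := by
    intro g C hC0 hg hC
    refine MemLp.of_bound hg.aestronglyMeasurable (C * Real.exp (l * ℓ)) ?_
    filter_upwards [ae_restrict_mem hTm] with p hp
    refine (hC _ _ hp.1).trans ?_
    have := hp.2.1
    gcongr
  have hM1 : MemLp (fun p : ℝ × ℝ => singularKernel h p.1 p.2) 2
      (volume.restrict (triangle ℓ)) := by
    have hi : Integrable fun s => ‖h s‖ ^ 2 := hh2.norm.integrable_sq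
    have hm := stronglyMeasurable_singularKernel hhm
    have hm2 : Measurable fun p : ℝ × ℝ => (p.2 + p.1) / 2 := by fun_prop
    -- For each `x` the integral of `|h((t+x)/2)|²` over all `t` is `2 ∫ |h|²`, a constant. Square
    -- integrability thus holds on the whole strip over `[0,ℓ]`, which contains the triangle.
    have hb : MemLp (fun p : ℝ × ℝ => h ((p.2 + p.1) / 2)) 2
        ((volume.restrict (Icc 0 ℓ)).prod volume) := by
      have hhc : StronglyMeasurable fun p : ℝ × ℝ => h ((p.2 + p.1) / 2) :=
        hhm.comp_measurable hm2
      have hhc2 : StronglyMeasurable fun p : ℝ × ℝ => ‖h ((p.2 + p.1) / 2)‖ ^ 2 :=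
        hhc.norm.pow 2
      rw [memLp_two_iff_integrable_sq_norm hhc.aestronglyMeasurable,
        integrable_prod_iff hhc2.aestronglyMeasurable]
      refine ⟨Filter.Eventually.of_forall fun x => integrable_comp_add_div_two hi x, ?_⟩
      simp only [norm_pow, norm_norm]
      simp_rw [integral_comp_add_div_two (fun t => ‖h t‖ ^ 2)]
      exact integrable_const _
    have hle : (volume : Measure (ℝ × ℝ)).restrict (triangle ℓ) ≤
        (volume.restrict (Icc 0 ℓ)).prod volume := by
      have e : (volume.restrict (Icc (0 : ℝ) ℓ)).prod (volume : Measure ℝ) =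
          (volume : Measure (ℝ × ℝ)).restrict (Icc 0 ℓ ×ˢ univ) := by
        rw [Measure.volume_eq_prod, ← Measure.prod_restrict, Measure.restrict_univ]
      rw [e]
      have hsub : triangle ℓ ⊆ Icc (0 : ℝ) ℓ ×ˢ (univ : Set ℝ) := fun p hp =>
        ⟨(hTsub hp).1, mem_univ _⟩
      exact Measure.restrict_mono hsub le_rfl
    refine (hb.mono_measure hle).of_le_mul (c := 1 / 2) hm.aestronglyMeasurable ?_
    exact Filter.Eventually.of_forall fun p => norm_singularKernel_le p.1 p.2
  exact (bd hB0 hPm hB).add (hM1.add (bd (by positivity) hAP hAPb))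

end Kernel

/-! ### The first-order system satisfied by the Fourier transforms of the kernel -/

/-- Factoring out `e^{ax}` leaves `x` only in the upper limit, so that regularity and derivative
follow from those of a primitive. -/
theorem duhamel_eq_mul (h m : ℝ → ℂ) (a c : ℂ) {x : ℝ} (hx : 0 ≤ x) :
    Complex.exp (a * x) * c + ∫ s in Ioc 0 x, h s * (Complex.exp (a * (x - s)) * m s) =
      Complex.exp (a * x) * (c + ∫ s in (0 : ℝ)..x, h s * (Complex.exp (-a * s) * m s)) := by
  rw [mul_add, intervalIntegral.integral_of_le hx, ← integral_const_mul]
  congr 2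
  funext s
  rw [mul_sub, sub_eq_add_neg, Complex.exp_add, neg_mul]
  ring

theorem memW12_exp {ℓ : ℝ} (a : ℂ) :
    MemW12 ℓ (fun x : ℝ => Complex.exp (a * x)) ∧ ∀ x : ℝ,
      HasDerivAt (fun x : ℝ => Complex.exp (a * x)) (a * Complex.exp (a * x)) x := by
  have hd : ∀ x : ℝ, HasDerivAt (fun x : ℝ => Complex.exp (a * x)) (a * Complex.exp (a * x)) x :=
    fun x => by
      have := ((hasDerivAt_id (x : ℂ)).const_mul a).cexp.comp_ofReal
      simpa [mul_comm] using this
  refine ⟨(MemW12.of_ae_hasDerivAt ?_ (g := fun x : ℝ => a * Complex.exp (a * x)) ?_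
    (Filter.Eventually.of_forall hd)).1, hd⟩
  · refine ContDiffOn.absolutelyContinuousOnInterval (ContDiff.contDiffOn ?_)
    exact (contDiff_const.mul Complex.ofRealCLM.contDiff).cexp
  · exact ContinuousOn.memLp_Ioo (by fun_prop)

section Duhamel

variable {ℓ : ℝ} {h p m : ℝ → ℂ} {a c : ℂ}

/-- This breaks a circle: `memW12_of_duhamel` needs the other wave to be continuous. Here
integrability of the Duhamel integrand at `x = ℓ` suffices, with no regularity of `m`. -/
theorem continuousOn_of_duhamel (hℓ : 0 ≤ ℓ)
    (hi : IntegrableOn (fun s : ℝ => h s * (Complex.exp (a * (ℓ - s)) * m s)) (Ioc 0 ℓ))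
    (hp : ∀ x ∈ Icc 0 ℓ, p x = Complex.exp (a * x) * c +
      ∫ s in Ioc 0 x, h s * (Complex.exp (a * (x - s)) * m s)) : ContinuousOn p (Icc 0 ℓ) := by
  have hj : IntervalIntegrable (fun s : ℝ => h s * (Complex.exp (-a * s) * m s)) volume 0 ℓ := by
    rw [intervalIntegrable_iff_integrableOn_Ioc_of_le hℓ]
    refine (hi.const_mul (Complex.exp (-a * ℓ))).congr (Filter.Eventually.of_forall fun s => ?_)
    have : Complex.exp (-a * s) = Complex.exp (-a * ℓ) * Complex.exp (a * (ℓ - s)) := by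
      rw [← Complex.exp_add]; congr 1; ring
    simp only [this]
    ring
  have hc : ContinuousOn (fun x : ℝ => Complex.exp (a * x) *
      (c + ∫ s in (0 : ℝ)..x, h s * (Complex.exp (-a * s) * m s))) (Icc 0 ℓ) :=
    ContinuousOn.mul (by fun_prop)
      (continuousOn_const.add (continuousOn_intervalIntegral_Icc hℓ hj))
  exact hc.congr fun x hx => by rw [hp x hx, duhamel_eq_mul _ _ _ _ hx.1]

theorem memW12_of_duhamel (hℓ : 0 ≤ ℓ) (hh : MemLp h 2 (volume.restrict (Ioo 0 ℓ)))
    (hm : ContinuousOn m (Icc 0 ℓ))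
    (hp : ∀ x ∈ Icc 0 ℓ, p x = Complex.exp (a * x) * c +
      ∫ s in Ioc 0 x, h s * (Complex.exp (a * (x - s)) * m s)) :
    MemW12 ℓ p ∧ deriv p =ᵐ[volume.restrict (Ioo 0 ℓ)] fun x => a * p x + h x * m x := by
  have hcm : ContinuousOn (fun s : ℝ => Complex.exp (-a * s) * m s) (Icc 0 ℓ) :=
    ContinuousOn.mul (by fun_prop) hm
  have hL : MemLp (fun s : ℝ => h s * (Complex.exp (-a * s) * m s)) 2
      (volume.restrict (Ioo 0 ℓ)) := by
    simpa only [mul_comm] using hh.mul_continuousOn_Icc hcm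
  obtain ⟨h1, d1⟩ := MemW12.of_eq_add_integral (c := c)
    (y := fun x => c + ∫ s in (0 : ℝ)..x, h s * (Complex.exp (-a * s) * m s)) hℓ hL
    (fun x _ => rfl)
  obtain ⟨h2, d2⟩ := memW12_exp (ℓ := ℓ) a
  obtain ⟨h3, d3⟩ := h2.mul hℓ h1
  have e : EqOn (fun x : ℝ => Complex.exp (a * x) *
      (c + ∫ s in (0 : ℝ)..x, h s * (Complex.exp (-a * s) * m s))) p (Icc 0 ℓ) := fun x hx => by
    simp only
    rw [hp x hx, duhamel_eq_mul _ _ _ _ hx.1]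
  have hac : AbsolutelyContinuousOnInterval p 0 ℓ :=
    h3.absolutelyContinuous.congr (by rwa [uIcc_of_le hℓ])
  have hd : deriv p =ᵐ[volume.restrict (Ioo 0 ℓ)] fun x => a * p x + h x * m x := by
    filter_upwards [d1, d3, ae_restrict_mem measurableSet_Ioo] with x e1 e3 hx
    have e4 : deriv p x = deriv (fun x : ℝ => Complex.exp (a * x) *
        (c + ∫ s in (0 : ℝ)..x, h s * (Complex.exp (-a * s) * m s))) x := by
      refine Filter.EventuallyEq.deriv_eq ?_
      filter_upwards [isOpen_Ioo.mem_nhds hx] with t ht using (e (Ioo_subset_Icc_self ht)).symm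
    have e5 : Complex.exp (a * x) * Complex.exp (-a * x) = 1 := by
      rw [← Complex.exp_add]; simp
    rw [e4, e3, e1, (d2 x).deriv, ← e (Ioo_subset_Icc_self hx)]
    linear_combination (h x * m x) * e5
  have hpL : MemLp (fun x => a * p x + h x * m x) 2 (volume.restrict (Ioo 0 ℓ)) := by
    have hpc : ContinuousOn p (Icc 0 ℓ) := (h3.continuousOn hℓ).congr e.symm
    have hhm := hh.mul_continuousOn_Icc hm
    refine (((continuousOn_const (c := a)).mul hpc).memLp_Ioo.add hhm).ae_eq
      (Filter.Eventually.of_forall fun x => ?_)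
    simp only [Pi.add_apply]
    simp [mul_comm]
  exact ⟨⟨hac, hpL.ae_eq hd.symm⟩, hd⟩

end Duhamel

section System

variable {h : ℝ → ℂ}

/-- The right-moving component of the solution. -/
def wavePlus (h : ℝ → ℂ) (ρ : ℂ) (x : ℝ) : ℂ :=
  Complex.exp (Complex.I * ρ * x) + ∫ t, kernelPlus h x t * Complex.exp (Complex.I * ρ * t)

/-- The left-moving component of the solution. -/
def waveMinus (h : ℝ → ℂ) (ρ : ℂ) (x : ℝ) : ℂ :=
  ∫ t, kernelMinus h x t * Complex.exp (Complex.I * ρ * t)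

/-- A function supported in the cone is integrable against exponentials. -/
theorem SupportedInCone.integrable_mul_exp {g : ℝ → ℝ → ℂ} (hgs : SupportedInCone g) {x : ℝ}
    (hg : Integrable (g x)) (ρ : ℂ) :
    Integrable fun t : ℝ => g x t * Complex.exp (Complex.I * ρ * t) := by
  refine Integrable.mono (hg.norm.mul_const (Real.exp (‖ρ‖ * x)))
    (hg.aestronglyMeasurable.mul (Continuous.aestronglyMeasurable (by fun_prop))) ?_
  refine Filter.Eventually.of_forall fun t => ?_
  rw [norm_mul, norm_mul (‖_‖) _, norm_norm, Real.norm_of_nonneg (Real.exp_pos _).le]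
  rcases le_or_gt |t| x with h1 | h1
  · gcongr
    refine (Complex.norm_exp_le_exp_norm _).trans (Real.exp_le_exp.2 ?_)
    rw [norm_mul, norm_mul, Complex.norm_I, one_mul, Complex.norm_real, Real.norm_eq_abs]
    gcongr
  · rw [hgs _ _ h1]
    simp

/-- These `L¹` bounds, uniform for `s ≤ x`, are what Fubini requires in `fourier_volterraShift`. The
bounded parts contribute through the width `2s` of their support, the singular part through `∫ |h|`.
-/
theorem exists_integral_norm_kernel_le (hh : Integrable h) (hh2 : MemLp h 2)
    (hhm : StronglyMeasurable h) (x : ℝ) :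
    ∃ C, ∀ s ∈ Icc 0 x, (Integrable (kernelPlus h s) ∧ ∫ t, ‖kernelPlus h s t‖ ≤ C) ∧
      (Integrable (volterraShift h (-1) (kernelPlus h) s)) ∧
      (Integrable (kernelMinus h s) ∧ ∫ t, ‖kernelMinus h s t‖ ≤ C) := by
  obtain ⟨l, hl0, hl⟩ := exists_setIntegral_norm_mul_exp_le hh2
  obtain ⟨B, hB0, hB⟩ := exists_norm_kernelPlus_le hh hh2 hl0.le hl
  have hPm := stronglyMeasurable_kernelPlus hh hh2 hhm
  have hAP := stronglyMeasurable_volterraShift (σ := -1) hhm hPm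
  have hAPb := norm_volterraShift_le (σ := -1) hh hl hB
  have hI : 0 ≤ ∫ t, ‖h t‖ := integral_nonneg fun t => norm_nonneg _
  refine ⟨2 * x * (B * Real.exp (l * x)) + ∫ t, ‖h t‖, fun s hs => ?_⟩
  have hs2 := hs.2
  have hs1 := hs.1
  have hx0 : 0 ≤ x := hs1.trans hs2
  have b1 : B * Real.exp (l * s) ≤ B * Real.exp (l * x) := by gcongr
  have b2 : B / 2 * Real.exp (l * s) ≤ B * Real.exp (l * x) :=
    mul_le_mul (by linarith) (by gcongr) (Real.exp_pos _).le hB0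
  have b3 : 2 * s * (B * Real.exp (l * x)) ≤ 2 * x * (B * Real.exp (l * x)) := by gcongr
  obtain ⟨i1, n1⟩ := supportedInCone_kernelPlus.integrable_of_bound hPm hs1
    (fun t => (hB s t hs1).trans b1)
  obtain ⟨i2, n2⟩ := (supportedInCone_kernelPlus.volterraShift (h := h) (σ := -1)
    (by simp)).integrable_of_bound hAP hs1 (fun t => (hAPb s t hs1).trans b2)
  obtain ⟨i3, n3⟩ := integrable_singularKernel hh hhm s
  refine ⟨⟨i1, by linarith⟩, i2, i3.add i2, ?_⟩
  calc ∫ t, ‖kernelMinus h s t‖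
      ≤ ∫ t, (‖singularKernel h s t‖ + ‖volterraShift h (-1) (kernelPlus h) s t‖) :=
        integral_mono (i3.add i2).norm (i3.norm.add i2.norm) fun t => norm_add_le _ _
    _ ≤ _ := by
        rw [integral_add i3.norm i2.norm]
        linarith

theorem wavePlus_eq (hh : Integrable h) (hh2 : MemLp h 2) (hhm : StronglyMeasurable h) (ρ : ℂ)
    {x : ℝ} (hx : 0 ≤ x) :
    IntegrableOn (fun s : ℝ => h s * (Complex.exp (Complex.I * ρ * (x - s)) * waveMinus h ρ s))
      (Ioc 0 x) ∧
    wavePlus h ρ x = Complex.exp (Complex.I * ρ * x) * 1 +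
      ∫ s in Ioc 0 x, h s * (Complex.exp (Complex.I * ρ * (x - s)) * waveMinus h ρ s) := by
  obtain ⟨C, hC⟩ := exists_integral_norm_kernel_le hh hh2 hhm x
  obtain ⟨-, i, e⟩ := fourier_volterraShift (σ := 1) hh hhm (by simp)
    (stronglyMeasurable_kernelMinus hh hh2 hhm) supportedInCone_kernelMinus
    (fun s hs => (hC s (Ioc_subset_Icc_self hs)).2.2) ρ
  simp only [Complex.ofReal_one, one_mul] at i e
  refine ⟨i, ?_⟩
  rw [wavePlus, mul_one]
  congr 1
  simp_rw [kernelPlus_eq hh hh2 hhm hx]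
  exact e

/-- The two summands of `kernelMinus` match the two summands of `wavePlus`: the singular kernel
accounts for the free exponential, the shifted `kernelPlus` for the rest. -/
theorem waveMinus_eq (hh : Integrable h) (hh2 : MemLp h 2) (hhm : StronglyMeasurable h) (ρ : ℂ)
    {x : ℝ} (hx : 0 ≤ x) :
    IntegrableOn (fun s : ℝ => h s * (Complex.exp (-(Complex.I * ρ) * (x - s)) * wavePlus h ρ s))
      (Ioc 0 x) ∧
    waveMinus h ρ x = Complex.exp (-(Complex.I * ρ) * x) * 0 +
      ∫ s in Ioc 0 x, h s * (Complex.exp (-(Complex.I * ρ) * (x - s)) * wavePlus h ρ s) := by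
  obtain ⟨C, hC⟩ := exists_integral_norm_kernel_le hh hh2 hhm x
  obtain ⟨-, i, e⟩ := fourier_volterraShift (σ := -1) hh hhm (by simp)
    (stronglyMeasurable_kernelPlus hh hh2 hhm) supportedInCone_kernelPlus
    (fun s hs => (hC s (Ioc_subset_Icc_self hs)).1) ρ
  have hexp : ∀ s : ℝ, Complex.exp (Complex.I * ρ * ((-1 : ℝ) * (x - s))) =
      Complex.exp (-(Complex.I * ρ) * (x - s)) := fun s => by
    congr 1; push_cast; ring
  have e0 := fourier_singularKernel (h := h) hx ρ
  simp only [hexp] at i e e0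
  have i0 : IntegrableOn (fun s : ℝ => h s * (Complex.exp (-(Complex.I * ρ) * (x - s)) *
      Complex.exp (Complex.I * ρ * s))) (Ioc 0 x) :=
    ((hh.integrableOn (s := Icc 0 x)).mul_continuousOn (by fun_prop) isCompact_Icc).mono_set
      Ioc_subset_Icc_self
  have es : ∀ s : ℝ, h s * (Complex.exp (-(Complex.I * ρ) * (x - s)) * wavePlus h ρ s) =
      h s * (Complex.exp (-(Complex.I * ρ) * (x - s)) * Complex.exp (Complex.I * ρ * s)) +
      h s * (Complex.exp (-(Complex.I * ρ) * (x - s)) *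
        ∫ t, kernelPlus h s t * Complex.exp (Complex.I * ρ * t)) := fun s => by
    rw [wavePlus]; ring
  simp only [es]
  refine ⟨i0.add i, ?_⟩
  have hxx : x ∈ Icc 0 x := right_mem_Icc.2 hx
  rw [mul_zero, zero_add, integral_add i0 i, ← e0, ← e, ← integral_add
    (supportedInCone_singularKernel.integrable_mul_exp (integrable_singularKernel hh hhm x).1 ρ)
    ((supportedInCone_kernelPlus.volterraShift (by simp)).integrable_mul_exp (hC x hxx).2.1 ρ)]
  simp only [waveMinus, kernelMinus, add_mul]

theorem transmutation_kernel_eq (hh : Integrable h) (hh2 : MemLp h 2) (hhm : StronglyMeasurable h)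
    (ρ : ℂ) {x : ℝ} (hx : 0 ≤ x) :
    transmutation (fun x t => kernelPlus h x t + kernelMinus h x t)
      (fun t => Complex.exp (Complex.I * ρ * t)) x = wavePlus h ρ x + waveMinus h ρ x := by
  obtain ⟨C, hC⟩ := exists_integral_norm_kernel_le hh hh2 hhm x
  obtain ⟨⟨i1, -⟩, -, i2, -⟩ := hC x (right_mem_Icc.2 hx)
  rw [transmutation, wavePlus, waveMinus, add_assoc, ← integral_add
    (supportedInCone_kernelPlus.integrable_mul_exp i1 ρ)
    (supportedInCone_kernelMinus.integrable_mul_exp i2 ρ),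
    intervalIntegral.integral_of_le (by linarith), ← integral_Icc_eq_integral_Ioc,
    setIntegral_eq_integral_of_forall_compl_eq_zero]
  · simp only [add_mul]
  · intro t ht
    have : x < |t| := not_le.1 fun hle => ht (abs_le.1 hle)
    rw [supportedInCone_kernelPlus x t this, supportedInCone_kernelMinus x t this]
    simp

end System

/-- Solutions of the system `y' = (f'/f) y + iρ z`, `z' = -(f'/f) z + iρ y` yield the solutions
`e_f(ρ,·)`. -/
theorem IsNonvanishingSolution.isExponentialSolution_of_system {ℓ : ℝ} (hℓ : 0 ≤ ℓ)
    {q : (ℝ → ℂ) → ℂ} (hq : IsW12ZeroDual ℓ q) {f : ℝ → ℂ} (hf : IsNonvanishingSolution ℓ q f)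
    {ρ : ℂ} {y z : ℝ → ℂ} (hy : MemW12 ℓ y) (hz : MemW12 ℓ z) (hy0 : y 0 = 1) (hz0 : z 0 = 1)
    (hyd : deriv y =ᵐ[volume.restrict (Ioo 0 ℓ)]
      fun x => deriv f x / f x * y x + Complex.I * ρ * z x)
    (hzd : deriv z =ᵐ[volume.restrict (Ioo 0 ℓ)]
      fun x => -(deriv f x / f x) * z x + Complex.I * ρ * y x) :
    IsExponentialSolution ℓ q f ρ y := by
  have hfW := hf.solution.memW12
  have hzc := hz.continuousOn hℓ
  refine ⟨hf.isSchrodingerSolution_of_integral hℓ hq hy fun ψ hψ => ?_, hy0,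
    fun x => Complex.I * ρ * z x, continuousOn_const.mul hzc, ?_, by simp [hz0]⟩
  -- By the system, `f y' - f' y = iρ f z` and `(f z)' = iρ f y`. Integrating by parts against `ψ`
  -- yields the factor `-(iρ)² = ρ²`.
  · obtain ⟨hfz, dfz⟩ := hfW.mul hℓ hz
    have h1 := hfz.integral_deriv_mul_add hℓ hψ.memW12
    have hψc := hψ.memW12.continuousOn hℓ
    have i1 := hfz.intervalIntegrable_deriv_mul hℓ hψc
    have i2 : IntervalIntegrable (fun x => f x * z x * deriv ψ x) volume 0 ℓ := by
      simpa only [mul_comm] using hψ.memW12.intervalIntegrable_deriv_mul hℓ (hfz.continuousOn hℓ)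
    rw [hψ.left, hψ.right, mul_zero, mul_zero, sub_zero, intervalIntegral.integral_add i1 i2] at h1
    have e1 : ∫ x in (0 : ℝ)..ℓ, (f x * deriv y x - deriv f x * y x) * deriv ψ x =
        Complex.I * ρ * ∫ x in (0 : ℝ)..ℓ, f x * z x * deriv ψ x := by
      rw [← intervalIntegral.integral_const_mul, intervalIntegral_eq_integral_Ioo hℓ,
        intervalIntegral_eq_integral_Ioo hℓ]
      refine integral_congr_ae ?_
      filter_upwards [hyd, ae_restrict_mem measurableSet_Ioo] with x e hx
      have := hf.ne_zero x (Ioo_subset_Icc_self hx)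
      rw [e]
      field_simp
      ring
    have e2 : ∫ x in (0 : ℝ)..ℓ, deriv (fun x => f x * z x) x * ψ x =
        Complex.I * ρ * ∫ x in (0 : ℝ)..ℓ, f x * y x * ψ x := by
      rw [← intervalIntegral.integral_const_mul, intervalIntegral_eq_integral_Ioo hℓ,
        intervalIntegral_eq_integral_Ioo hℓ]
      refine integral_congr_ae ?_
      filter_upwards [hzd, dfz, ae_restrict_mem measurableSet_Ioo] with x e e' hx
      have := hf.ne_zero x (Ioo_subset_Icc_self hx)
      rw [e', e]
      field_simp
      ring
    rw [e2] at h1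
    rw [e1, eq_neg_of_add_eq_zero_right h1]
    linear_combination (-ρ ^ 2 * ∫ x in (0 : ℝ)..ℓ, f x * y x * ψ x) * Complex.I_sq
  · filter_upwards [hyd] with x e
    rw [darbouxD, e]
    ring

theorem IsNonvanishingSolution.exists_isTransmutationKernel {ℓ : ℝ} (hℓ : 0 < ℓ)
    {q : (ℝ → ℂ) → ℂ} (hq : IsW12ZeroDual ℓ q) {f : ℝ → ℂ} (hf : IsNonvanishingSolution ℓ q f) :
    ∃ K : ℝ → ℝ → ℂ, IsTransmutationKernel ℓ q f K := by
  have hfW := hf.solution.memW12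
  have hL : MemLp (fun x => (f x)⁻¹ * deriv f x) 2 (volume.restrict (Ioo 0 ℓ)) :=
    hfW.memLp_deriv.mul_continuousOn_Icc ((hfW.continuousOn hℓ.le).inv₀ hf.ne_zero)
  -- The kernel is built from pointwise values of `h` along characteristics, so a strongly
  -- measurable representative of `f'/f`, extended by zero to the line, is fixed.
  set h : ℝ → ℂ := (Ioo 0 ℓ).indicator (hL.1.mk _) with hh
  have hhm : StronglyMeasurable h := hL.1.stronglyMeasurable_mk.indicator measurableSet_Ioo
  have hhf : h =ᵐ[volume.restrict (Ioo 0 ℓ)] fun x => deriv f x / f x := by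
    filter_upwards [hL.1.ae_eq_mk, ae_restrict_mem measurableSet_Ioo] with x e hx
    rw [hh, indicator_of_mem hx, ← e, div_eq_inv_mul]
  have hh2 : MemLp h 2 :=
    (memLp_indicator_iff_restrict measurableSet_Ioo).2 (hL.ae_eq hL.1.ae_eq_mk)
  have hh1 : Integrable h :=
    (integrable_indicator_iff measurableSet_Ioo).2
      ((hL.integrable (by norm_num)).congr hL.1.ae_eq_mk)
  refine ⟨fun x t => kernelPlus h x t + kernelMinus h x t, memLp_kernel hh1 hh2 hhm ℓ,
    fun x hx => ?_, fun ρ => ⟨fun x => wavePlus h ρ x + waveMinus h ρ x, ?_, fun x hx =>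
      (transmutation_kernel_eq hh1 hh2 hhm ρ hx.1.le).symm⟩⟩
  · obtain ⟨C, hC⟩ := exists_integral_norm_kernel_le hh1 hh2 hhm x
    obtain ⟨⟨i1, -⟩, -, i2, -⟩ := hC x (right_mem_Icc.2 hx.1.le)
    exact (i1.add i2).intervalIntegrable
  · have hP := fun x (hx : x ∈ Icc 0 ℓ) => (wavePlus_eq hh1 hh2 hhm ρ hx.1).2
    have hM := fun x (hx : x ∈ Icc 0 ℓ) => (waveMinus_eq hh1 hh2 hhm ρ hx.1).2
    have hPc := continuousOn_of_duhamel hℓ.le (wavePlus_eq hh1 hh2 hhm ρ hℓ.le).1 hP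
    have hMc := continuousOn_of_duhamel hℓ.le (waveMinus_eq hh1 hh2 hhm ρ hℓ.le).1 hM
    obtain ⟨hPW, hPd⟩ := memW12_of_duhamel hℓ.le (hh2.restrict _) hMc hP
    obtain ⟨hMW, hMd⟩ := memW12_of_duhamel hℓ.le (hh2.restrict _) hPc hM
    have hP0 : wavePlus h ρ 0 = 1 := by simp [hP 0 (left_mem_Icc.2 hℓ.le)]
    have hM0 : waveMinus h ρ 0 = 0 := by simp [hM 0 (left_mem_Icc.2 hℓ.le)]
    have dP := hPW.ae_hasDerivAt hℓ.le
    have dM := hMW.ae_hasDerivAt hℓ.le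
    refine hf.isExponentialSolution_of_system hℓ.le hq
      (y := fun x => wavePlus h ρ x + waveMinus h ρ x)
      (z := fun x => wavePlus h ρ x - waveMinus h ρ x)
      (MemW12.of_ae_hasDerivAt (hPW.absolutelyContinuous.fun_add hMW.absolutelyContinuous)
        (hPW.memLp_deriv.add hMW.memLp_deriv) ?_).1
      (MemW12.of_ae_hasDerivAt (hPW.absolutelyContinuous.fun_sub hMW.absolutelyContinuous)
        (hPW.memLp_deriv.sub hMW.memLp_deriv) ?_).1
      (by simp [hP0, hM0]) (by simp [hP0, hM0]) ?_ ?_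
    · filter_upwards [dP, dM] with x h1 h2 using h1.add h2
    · filter_upwards [dP, dM] with x h1 h2 using h1.sub h2
    · filter_upwards [dP, dM, hPd, hMd, hhf] with x h1 h2 e1 e2 e3
      rw [(h1.fun_add h2).deriv, e1, e2, ← e3]
      ring
    · filter_upwards [dP, dM, hPd, hMd, hhf] with x h1 h2 e1 e2 e3
      rw [(h1.fun_sub h2).deriv, e1, e2, ← e3]
      ring

end

theorem mainTheorem2 (ℓ : ℝ) (hℓ : 0 < ℓ) (q : (ℝ → ℂ) → ℂ) (hq : IsW12ZeroDual ℓ q)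
    (f : ℝ → ℂ) (hf : IsNonvanishingSolution ℓ q f) :
    (∃ K : ℝ → ℝ → ℂ, IsTransmutationKernel ℓ q f K) ∧
    ∀ K : ℝ → ℝ → ℂ, IsTransmutationKernel ℓ q f K →
      ∀ k : ℕ, ∀ x ∈ Ioo 0 ℓ,
        transmutation K (fun t => (t : ℂ) ^ k) x = formalPower f k x :=
  ⟨hf.exists_isTransmutationKernel hℓ hq, fun _ hK k _ hx => hK.transmutation_pow hℓ hf k hx⟩
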